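/- Let $0<q<1$, $q=e^{-h/2}$. **The quantum algebra.** Let $U_q\mathfrak{su}(1,1)$ be the unital complex algebra generated by $H$, $X^{\pm}$ and $k^{\pm1}$, where $k=e^{-hH/4}=q^{H/2}$, with the relations $kk^{-1}=k^{-1}k=1$, $kH=Hk$, $kX^{\pm}=q^{\pm1}X^{\pm}k$, $[H,X^{\pm}]=\pm2X^{\pm}$ and $[X^+,X^-]=\frac{k^2-k^{-2}}{q-q^{-1}}$. Its counit is given by $\varepsilon(H)=\varepsilon(X^{\pm})=0$, $\varepsilon(k^{\pm1})=1$. **Polynomials.** Let $\mathrm{Pol}(\widetilde X)_q$ be the unital complex algebra with generators $t_{11},t_{12},t_{21},t_{22}$ and relations $$t_{11}t_{12}=qt_{12}t_{11},\quad t_{21}t_{22}=qt_{22}t_{21},\quad t_{11}t_{21}=qt_{21}t_{11},\quad t_{12}t_{22}=qt_{22}t_{12},\quad t_{12}t_{21}=t_{21}t_{12},$$ $$t_{11}t_{22}-t_{22}t_{11}=(q-q^{-1})t_{12}t_{21},\qquad t_{11}t_{22}-qt_{12}t_{21}=1,$$ and put $t_{11}^*=-t_{22}$, $t_{12}^*=-qt_{21}$,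 $x=t_{12}t_{12}^*$. The algebra $U_q\mathfrak{su}(1,1)$ acts on it by $Ht_{i1}=t_{i1}$, $Ht_{i2}=-t_{i2}$, $X^+t_{i1}=0$, $X^+t_{i2}=t_{i1}$, $X^-t_{i1}=t_{i2}$, $X^-t_{i2}=0$, $k^{\pm1}t_{i1}=q^{\pm1/2}t_{i1}$, $k^{\pm1}t_{i2}=q^{\mp1/2}t_{i2}$ ($i=1,2$), by $k^{\pm1}(fg)=(k^{\pm1}f)(k^{\pm1}g)$, $H(fg)=(Hf)g+f(Hg)$, $X^{\pm}(fg)=(X^{\pm}f)(k^{-1}g)+(kf)(X^{\pm}g)$, and by $\xi 1=\varepsilon(\xi)1$. **Distributions and finite functions.** Let $M''=\{(i_1,i_2,j_1,j_2)\in\mathbb Z_+^4 : i_1j_1=i_2j_2=0\}$. Let $D(\widetilde X)_q'$ be the space of formal series $$f=\sum_{(i_1,i_2,j_1,j_2)\in M''}t_{11}^{i_1}t_{12}^{i_2}\,\psi_{i_1i_2j_1j_2}(x)\,t_{12}^{*j_2}t_{11}^{*j_1}$$ whose coefficients are arbitrary functions $\psi_{i_1i_2j_1j_2}:q^{-2\mathbb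 Z_+}\to\mathbb C$, with the topology of pointwise convergence of the coefficients. The finite sums of this form with polynomial coefficients are the elements of $\mathrm{Pol}(\widetilde X)_q\subset D(\widetilde X)_q'$. Let $D(\widetilde X)_q\subset D(\widetilde X)_q'$ be the subspace of those $f$ for which only finitely many of the numbers $\psi_{i_1i_2j_1j_2}(q^{-2m})$ (with $(i_1,i_2,j_1,j_2)\in M''$, $m\in\mathbb Z_+$) are non-zero. **Proposition 3.2.** The action of $U_q\mathfrak{su}(1,1)$ on $\mathrm{Pol}(\widetilde X)_q$ extends to $D(\widetilde X)_q'$ as an action by continuous linear operators in exactly one way. This extended action preserves $D(\widetilde X)_q$, and with respect to it the linear functional $$\nu:D(\widetilde X)_q\to\mathbb C,\qquad \nu(f)=(1-q^2)\sum_{m=0}^{\infty}\psi_{0000}(q^{-2m})\,q^{-2m},$$ is a $U_q\mathfrak{su}(1,1)$-invariant integral, that is, $$\nu(\xi f)=\varepsilon(\xi)\,\nu(f)\qquad\text{for all }\xi\in U_q\mathfrak{su}(1,1),\ f\in D(\widetilde X)_q.$$ -/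

import Mathlib

noncomputable section

namespace QuantumSU11

/-! ### The quantum universal enveloping algebra `U_q su(1,1)` -/

/-- Generators of `U_q sl_2`: `H`, `X⁺`, `X⁻`, and `k = e^{-hH/4} = q^{H/2}` with its inverse
(here `q = e^{-h/2}`). -/
inductive UGen
  | H | Xp | Xm | k | kinv

/-- The defining relations of `U_q sl_2`: `[H, X^±] = ±2 X^±`,
`[X⁺, X⁻] = sh(hH/2) / sh(h/2) = (k² - k⁻²) / (q - q⁻¹)`, and the commutation relations of
`k = q^{H/2}` with the other generators. -/
inductive URel (q : ℝ) : FreeAlgebra ℂ UGen → FreeAlgebra ℂ UGen → Prop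
  | k_kinv : URel q (FreeAlgebra.ι ℂ UGen.k * FreeAlgebra.ι ℂ UGen.kinv) 1
  | kinv_k : URel q (FreeAlgebra.ι ℂ UGen.kinv * FreeAlgebra.ι ℂ UGen.k) 1
  | k_H : URel q (FreeAlgebra.ι ℂ UGen.k * FreeAlgebra.ι ℂ UGen.H)
      (FreeAlgebra.ι ℂ UGen.H * FreeAlgebra.ι ℂ UGen.k)
  | k_Xp : URel q (FreeAlgebra.ι ℂ UGen.k * FreeAlgebra.ι ℂ UGen.Xp)
      ((q : ℂ) • (FreeAlgebra.ι ℂ UGen.Xp * FreeAlgebra.ι ℂ UGen.k))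
  | k_Xm : URel q (FreeAlgebra.ι ℂ UGen.k * FreeAlgebra.ι ℂ UGen.Xm)
      ((q : ℂ)⁻¹ • (FreeAlgebra.ι ℂ UGen.Xm * FreeAlgebra.ι ℂ UGen.k))
  | H_Xp : URel q
      (FreeAlgebra.ι ℂ UGen.H * FreeAlgebra.ι ℂ UGen.Xp
        - FreeAlgebra.ι ℂ UGen.Xp * FreeAlgebra.ι ℂ UGen.H)
      ((2 : ℂ) • FreeAlgebra.ι ℂ UGen.Xp)
  | H_Xm : URel q
      (FreeAlgebra.ι ℂ UGen.H * FreeAlgebra.ι ℂ UGen.Xm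
        - FreeAlgebra.ι ℂ UGen.Xm * FreeAlgebra.ι ℂ UGen.H)
      ((-2 : ℂ) • FreeAlgebra.ι ℂ UGen.Xm)
  | Xp_Xm : URel q
      (FreeAlgebra.ι ℂ UGen.Xp * FreeAlgebra.ι ℂ UGen.Xm
        - FreeAlgebra.ι ℂ UGen.Xm * FreeAlgebra.ι ℂ UGen.Xp)
      (((q : ℂ) - (q : ℂ)⁻¹)⁻¹ •
        (FreeAlgebra.ι ℂ UGen.k ^ 2 - FreeAlgebra.ι ℂ UGen.kinv ^ 2))

/-- The algebra `U_q su(1,1)` (that is, `U_q sl_2`; its involution plays no role for the notion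
of an invariant integral). -/
abbrev Uq (q : ℝ) : Type := RingQuot (URel q)

/-- The values of the counit on generators. -/
def counitGen : UGen → ℂ
  | .H => 0
  | .Xp => 0
  | .Xm => 0
  | .k => 1
  | .kinv => 1

/-- The counit `ε : U_q su(1,1) → ℂ`, with `ε(H) = ε(X^±) = 0` and `ε(k^{±1}) = 1`. -/
def counit (q : ℝ) : Uq q →ₐ[ℂ] ℂ :=
  RingQuot.liftAlgHom ℂ ⟨FreeAlgebra.lift ℂ counitGen, by
    intro x y h
    cases h <;> simp only [map_mul, map_sub, map_smul, map_pow, map_one,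
      FreeAlgebra.lift_ι_apply, counitGen] <;> simp⟩

/-- A linear functional `μ` on a `U_q su(1,1)`-module (given by a representation `σ`) is an
invariant integral if it is a morphism to the trivial module. -/
def IsInvariantIntegral {q : ℝ} {M : Type*} [AddCommGroup M] [Module ℂ M]
    (σ : Uq q →ₐ[ℂ] Module.End ℂ M) (μ : M →ₗ[ℂ] ℂ) : Prop :=
  ∀ (ξ : Uq q) (f : M), μ (σ ξ f) = counit q ξ * μ f

/-! ### The algebra of polynomials on the quantum principal homogeneous space -/

/-- The generators `t_{ij}` of `ℂ[SL_2]_q`. -/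
inductive TGen
  | t11 | t12 | t21 | t22

/-- The defining relations of `ℂ[SL_2]_q` for four elements of a complex algebra. -/
structure IsQuantumSL2 (q : ℝ) {A : Type*} [Ring A] [Algebra ℂ A] (t : TGen → A) : Prop where
  r1 : t .t11 * t .t12 = (q : ℂ) • (t .t12 * t .t11)
  r2 : t .t21 * t .t22 = (q : ℂ) • (t .t22 * t .t21)
  r3 : t .t11 * t .t21 = (q : ℂ) • (t .t21 * t .t11)
  r4 : t .t12 * t .t22 = (q : ℂ) • (t .t22 * t .t12)
  r5 : t .t12 * t .t21 = t .t21 * t .t12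
  r6 : t .t11 * t .t22 - t .t22 * t .t11 = ((q : ℂ) - (q : ℂ)⁻¹) • (t .t12 * t .t21)
  r7 : t .t11 * t .t22 - (q : ℂ) • (t .t12 * t .t21) = 1

/-- The same relations, as a relation on the free algebra on the `t_{ij}`. -/
inductive TRel (q : ℝ) : FreeAlgebra ℂ TGen → FreeAlgebra ℂ TGen → Prop
  | r1 : TRel q (FreeAlgebra.ι ℂ TGen.t11 * FreeAlgebra.ι ℂ TGen.t12)
      ((q : ℂ) • (FreeAlgebra.ι ℂ TGen.t12 * FreeAlgebra.ι ℂ TGen.t11))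
  | r2 : TRel q (FreeAlgebra.ι ℂ TGen.t21 * FreeAlgebra.ι ℂ TGen.t22)
      ((q : ℂ) • (FreeAlgebra.ι ℂ TGen.t22 * FreeAlgebra.ι ℂ TGen.t21))
  | r3 : TRel q (FreeAlgebra.ι ℂ TGen.t11 * FreeAlgebra.ι ℂ TGen.t21)
      ((q : ℂ) • (FreeAlgebra.ι ℂ TGen.t21 * FreeAlgebra.ι ℂ TGen.t11))
  | r4 : TRel q (FreeAlgebra.ι ℂ TGen.t12 * FreeAlgebra.ι ℂ TGen.t22)
      ((q : ℂ) • (FreeAlgebra.ι ℂ TGen.t22 * FreeAlgebra.ι ℂ TGen.t12))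
  | r5 : TRel q (FreeAlgebra.ι ℂ TGen.t12 * FreeAlgebra.ι ℂ TGen.t21)
      (FreeAlgebra.ι ℂ TGen.t21 * FreeAlgebra.ι ℂ TGen.t12)
  | r6 : TRel q
      (FreeAlgebra.ι ℂ TGen.t11 * FreeAlgebra.ι ℂ TGen.t22
        - FreeAlgebra.ι ℂ TGen.t22 * FreeAlgebra.ι ℂ TGen.t11)
      (((q : ℂ) - (q : ℂ)⁻¹) • (FreeAlgebra.ι ℂ TGen.t12 * FreeAlgebra.ι ℂ TGen.t21))
  | r7 : TRel q
      (FreeAlgebra.ι ℂ TGen.t11 * FreeAlgebra.ι ℂ TGen.t22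
        - (q : ℂ) • (FreeAlgebra.ι ℂ TGen.t12 * FreeAlgebra.ι ℂ TGen.t21)) 1

/-- `Pol(X̃)_q`, which is `ℂ[SL_2]_q` as an algebra. -/
abbrev Pol (q : ℝ) : Type := RingQuot (TRel q)

/-- The generators as elements of `Pol(X̃)_q`. -/
def tPol (q : ℝ) (g : TGen) : Pol q := RingQuot.mkAlgHom ℂ (TRel q) (FreeAlgebra.ι ℂ g)

theorem isQuantumSL2_tPol (q : ℝ) : IsQuantumSL2 q (tPol q) where
  r1 := by simpa only [tPol, map_mul, map_smul] using
    RingQuot.mkAlgHom_rel ℂ (TRel.r1 (q := q))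
  r2 := by simpa only [tPol, map_mul, map_smul] using
    RingQuot.mkAlgHom_rel ℂ (TRel.r2 (q := q))
  r3 := by simpa only [tPol, map_mul, map_smul] using
    RingQuot.mkAlgHom_rel ℂ (TRel.r3 (q := q))
  r4 := by simpa only [tPol, map_mul, map_smul] using
    RingQuot.mkAlgHom_rel ℂ (TRel.r4 (q := q))
  r5 := by simpa only [tPol, map_mul, map_smul] using
    RingQuot.mkAlgHom_rel ℂ (TRel.r5 (q := q))
  r6 := by simpa only [tPol, map_mul, map_sub, map_smul] using
    RingQuot.mkAlgHom_rel ℂ (TRel.r6 (q := q))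
  r7 := by simpa only [tPol, map_mul, map_sub, map_smul, map_one] using
    RingQuot.mkAlgHom_rel ℂ (TRel.r7 (q := q))

/-- The universal property of `ℂ[SL_2]_q`. -/
def polLift {q : ℝ} {A : Type*} [Ring A] [Algebra ℂ A] (t : TGen → A)
    (ht : IsQuantumSL2 q t) : Pol q →ₐ[ℂ] A :=
  RingQuot.liftAlgHom ℂ ⟨FreeAlgebra.lift ℂ t, by
    intro x y h
    cases h
    · simpa only [map_mul, map_smul, FreeAlgebra.lift_ι_apply] using ht.r1
    · simpa only [map_mul, map_smul, FreeAlgebra.lift_ι_apply] using ht.r2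
    · simpa only [map_mul, map_smul, FreeAlgebra.lift_ι_apply] using ht.r3
    · simpa only [map_mul, map_smul, FreeAlgebra.lift_ι_apply] using ht.r4
    · simpa only [map_mul, map_smul, FreeAlgebra.lift_ι_apply] using ht.r5
    · simpa only [map_mul, map_sub, map_smul, FreeAlgebra.lift_ι_apply] using ht.r6
    · simpa only [map_mul, map_sub, map_smul, map_one, FreeAlgebra.lift_ι_apply] using ht.r7⟩

theorem polLift_tPol {q : ℝ} {A : Type*} [Ring A] [Algebra ℂ A] (t : TGen → A)
    (ht : IsQuantumSL2 q t) (g : TGen) : polLift t ht (tPol q g) = t g := by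
  simp [polLift, tPol]

theorem pol_induction {q : ℝ} {P : Pol q → Prop} (halg : ∀ c : ℂ, P (algebraMap ℂ _ c))
    (hgen : ∀ g, P (tPol q g)) (hmul : ∀ a b, P a → P b → P (a * b))
    (hadd : ∀ a b, P a → P b → P (a + b)) (a : Pol q) : P a := by
  obtain ⟨a, rfl⟩ := RingQuot.mkAlgHom_surjective ℂ (TRel q) a
  induction a using FreeAlgebra.induction with
  | grade0 c => rw [AlgHom.commutes]; exact halg c
  | grade1 g => exact hgen g
  | mul a b ha hb => rw [map_mul]; exact hmul _ _ ha hb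
  | add a b ha hb => rw [map_add]; exact hadd _ _ ha hb

/-- Upper triangular `2 × 2` matrices, used to construct twisted derivations. -/
theorem isQuantumSL2_triangular {q : ℝ} {A : Type*} [Ring A] [Algebra ℂ A] (a d b : TGen → A)
    (ha : IsQuantumSL2 q a) (hb : IsQuantumSL2 q b)
    (h1 : a .t11 * d .t12 + d .t11 * b .t12 = (q : ℂ) • (a .t12 * d .t11 + d .t12 * b .t11))
    (h2 : a .t21 * d .t22 + d .t21 * b .t22 = (q : ℂ) • (a .t22 * d .t21 + d .t22 * b .t21))
    (h3 : a .t11 * d .t21 + d .t11 * b .t21 = (q : ℂ) • (a .t21 * d .t11 + d .t21 * b .t11))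
    (h4 : a .t12 * d .t22 + d .t12 * b .t22 = (q : ℂ) • (a .t22 * d .t12 + d .t22 * b .t12))
    (h5 : a .t12 * d .t21 + d .t12 * b .t21 = a .t21 * d .t12 + d .t21 * b .t12)
    (h6 : a .t11 * d .t22 + d .t11 * b .t22 - (a .t22 * d .t11 + d .t22 * b .t11)
      = ((q : ℂ) - (q : ℂ)⁻¹) • (a .t12 * d .t21 + d .t12 * b .t21))
    (h7 : a .t11 * d .t22 + d .t11 * b .t22 - (q : ℂ) • (a .t12 * d .t21 + d .t12 * b .t21) = 0) :
    IsQuantumSL2 q (fun g => !![a g, d g; 0, b g]) where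
  r1 := by
    ext i j; fin_cases i <;> fin_cases j
    · simpa [Matrix.mul_apply, Fin.sum_univ_two] using ha.r1
    · simpa [Matrix.mul_apply, Fin.sum_univ_two] using h1
    · simp [Matrix.mul_apply, Fin.sum_univ_two]
    · simpa [Matrix.mul_apply, Fin.sum_univ_two] using hb.r1
  r2 := by
    ext i j; fin_cases i <;> fin_cases j
    · simpa [Matrix.mul_apply, Fin.sum_univ_two] using ha.r2
    · simpa [Matrix.mul_apply, Fin.sum_univ_two] using h2
    · simp [Matrix.mul_apply, Fin.sum_univ_two]
    · simpa [Matrix.mul_apply, Fin.sum_univ_two] using hb.r2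
  r3 := by
    ext i j; fin_cases i <;> fin_cases j
    · simpa [Matrix.mul_apply, Fin.sum_univ_two] using ha.r3
    · simpa [Matrix.mul_apply, Fin.sum_univ_two] using h3
    · simp [Matrix.mul_apply, Fin.sum_univ_two]
    · simpa [Matrix.mul_apply, Fin.sum_univ_two] using hb.r3
  r4 := by
    ext i j; fin_cases i <;> fin_cases j
    · simpa [Matrix.mul_apply, Fin.sum_univ_two] using ha.r4
    · simpa [Matrix.mul_apply, Fin.sum_univ_two] using h4
    · simp [Matrix.mul_apply, Fin.sum_univ_two]
    · simpa [Matrix.mul_apply, Fin.sum_univ_two] using hb.r4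
  r5 := by
    ext i j; fin_cases i <;> fin_cases j
    · simpa [Matrix.mul_apply, Fin.sum_univ_two] using ha.r5
    · simpa [Matrix.mul_apply, Fin.sum_univ_two] using h5
    · simp [Matrix.mul_apply, Fin.sum_univ_two]
    · simpa [Matrix.mul_apply, Fin.sum_univ_two] using hb.r5
  r6 := by
    ext i j; fin_cases i <;> fin_cases j
    · simpa [Matrix.mul_apply, Fin.sum_univ_two] using ha.r6
    · simpa [Matrix.mul_apply, Fin.sum_univ_two] using h6
    · simp
    · simpa [Matrix.mul_apply, Fin.sum_univ_two] using hb.r6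
  r7 := by
    ext i j; fin_cases i <;> fin_cases j
    · simpa [Matrix.mul_apply, Fin.sum_univ_two] using ha.r7
    · simpa [Matrix.mul_apply, Fin.sum_univ_two] using h7
    · simp
    · simpa [Matrix.mul_apply, Fin.sum_univ_two] using hb.r7

/-! ### The action of `U_q su(1,1)` on `Pol(X̃)_q` -/

/-- The weights: `H t_{i1} = t_{i1}`, `H t_{i2} = -t_{i2}`. -/
def wt : TGen → ℤ
  | .t11 => 1
  | .t12 => -1
  | .t21 => 1
  | .t22 => -1

/-- `X⁺ t_{i1} = 0`, `X⁺ t_{i2} = t_{i1}`. -/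
def XpGen (q : ℝ) : TGen → Pol q
  | .t11 => 0
  | .t12 => tPol q .t11
  | .t21 => 0
  | .t22 => tPol q .t21

/-- `X⁻ t_{i1} = t_{i2}`, `X⁻ t_{i2} = 0`. -/
def XmGen (q : ℝ) : TGen → Pol q
  | .t11 => tPol q .t12
  | .t12 => 0
  | .t21 => tPol q .t22
  | .t22 => 0

theorem isQuantumSL2_scale {q : ℝ} {A : Type*} [Ring A] [Algebra ℂ A] (t : TGen → A)
    (ht : IsQuantumSL2 q t) (c : ℂ) (hc : c ≠ 0) :
    IsQuantumSL2 q (fun g => c ^ wt g • t g) where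
  r1 := by simp [wt, smul_smul, hc, ht.r1]
  r2 := by simp [wt, smul_smul, hc, ht.r2]
  r3 := by simp only [wt, smul_mul_smul_comm, ht.r3, smul_smul, mul_comm]
  r4 := by simp only [wt, smul_mul_smul_comm, ht.r4, smul_smul, mul_comm]
  r5 := by simp [wt, smul_smul, hc, ht.r5]
  r6 := by simpa [wt, smul_smul, hc] using ht.r6
  r7 := by simpa [wt, smul_smul, hc] using ht.r7

/-- `q^{1/2}` as a complex number. -/
def qh (q : ℝ) : ℂ := (Real.sqrt q : ℂ)

theorem qh_ne_zero {q : ℝ} (hq : q ∈ Set.Ioo (0 : ℝ) 1) : qh q ≠ 0 := by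
  have := (Real.sqrt_pos.mpr hq.1).ne'
  simpa [qh] using this

theorem qh_mul_self {q : ℝ} (hq : q ∈ Set.Ioo (0 : ℝ) 1) : (q : ℂ) = qh q * qh q := by
  rw [qh, ← Complex.ofReal_mul, Real.mul_self_sqrt hq.1.le]

theorem isQuantumSL2_H (q : ℝ) :
    IsQuantumSL2 q (fun g => !![tPol q g, ((wt g : ℤ) : ℂ) • tPol q g; 0, tPol q g]) := by
  have h := isQuantumSL2_tPol q
  apply isQuantumSL2_triangular (tPol q) (fun g => ((wt g : ℤ) : ℂ) • tPol q g) (tPol q) h h <;>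
    simp only [wt, smul_mul_assoc, mul_smul_comm, h.r3, h.r4, Int.cast_one, Int.cast_neg, h.r5] <;>
    module

theorem isQuantumSL2_Xp {q : ℝ} (hq : q ∈ Set.Ioo (0 : ℝ) 1) :
    IsQuantumSL2 q (fun g => !![qh q ^ wt g • tPol q g, XpGen q g; 0,
      (qh q)⁻¹ ^ wt g • tPol q g]) := by
  have h := isQuantumSL2_tPol q
  have h0 := qh_ne_zero hq
  have hs := qh_mul_self hq
  have h6 := sub_eq_iff_eq_add.mp h.r6
  apply isQuantumSL2_triangular (fun g => qh q ^ wt g • tPol q g) (XpGen q)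
    (fun g => (qh q)⁻¹ ^ wt g • tPol q g) (isQuantumSL2_scale _ h _ h0)
    (isQuantumSL2_scale _ h _ (inv_ne_zero h0)) <;>
    simp only [wt, XpGen, smul_mul_assoc, mul_smul_comm, h6, h.r3, h.r5, hs, zpow_one, zpow_neg,
      mul_zero, zero_mul, smul_zero, add_zero, zero_add, inv_inv] <;>
    match_scalars <;> field_simp <;> ring

theorem isQuantumSL2_Xm {q : ℝ} (hq : q ∈ Set.Ioo (0 : ℝ) 1) :
    IsQuantumSL2 q (fun g => !![qh q ^ wt g • tPol q g, XmGen q g; 0,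
      (qh q)⁻¹ ^ wt g • tPol q g]) := by
  have h := isQuantumSL2_tPol q
  have h0 := qh_ne_zero hq
  have hs := qh_mul_self hq
  have h6 := sub_eq_iff_eq_add.mp h.r6
  apply isQuantumSL2_triangular (fun g => qh q ^ wt g • tPol q g) (XmGen q)
    (fun g => (qh q)⁻¹ ^ wt g • tPol q g) (isQuantumSL2_scale _ h _ h0)
    (isQuantumSL2_scale _ h _ (inv_ne_zero h0)) <;>
    simp only [wt, XmGen, smul_mul_assoc, mul_smul_comm, h6, h.r4, h.r5, hs, zpow_one, zpow_neg,
      mul_zero, zero_mul, smul_zero, add_zero, zero_add, inv_inv] <;>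
    match_scalars <;> field_simp <;> ring

/-- The action of `k = q^{H/2}` (for `c = q^{1/2}`) and of `k⁻¹` (for `c = q^{-1/2}`): the algebra
automorphism with `t_{ij} ↦ c^{wt(t_{ij})} t_{ij}`. -/
def scaleAlg (q : ℝ) (c : ℂ) (hc : c ≠ 0) : Pol q →ₐ[ℂ] Pol q :=
  polLift _ (isQuantumSL2_scale _ (isQuantumSL2_tPol q) c hc)

/-- The upper right corner of a homomorphism to `2 × 2` matrices. -/
def corner {q : ℝ} (T : Pol q →ₐ[ℂ] Matrix (Fin 2) (Fin 2) (Pol q)) : Module.End ℂ (Pol q) where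
  toFun f := T f 0 1
  map_add' f g := by simp
  map_smul' c f := by simp

theorem corner_apply {q : ℝ} (T : Pol q →ₐ[ℂ] Matrix (Fin 2) (Fin 2) (Pol q)) (f : Pol q) :
    corner T f = T f 0 1 := rfl

/-- The action of `k = e^{-hH/4}`. -/
def opK {q : ℝ} (hq : q ∈ Set.Ioo (0 : ℝ) 1) : Pol q →ₐ[ℂ] Pol q :=
  scaleAlg q (qh q) (qh_ne_zero hq)

/-- The action of `k⁻¹ = e^{hH/4}`. -/
def opKinv {q : ℝ} (hq : q ∈ Set.Ioo (0 : ℝ) 1) : Pol q →ₐ[ℂ] Pol q :=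
  scaleAlg q (qh q)⁻¹ (inv_ne_zero (qh_ne_zero hq))

/-- The action of `H`; see `opH_gen` and `opH_mul` for the properties that determine it. -/
def opH (q : ℝ) : Module.End ℂ (Pol q) := corner (polLift _ (isQuantumSL2_H q))

/-- The action of `X⁺`; see `opXp_gen` and `opXp_mul` for the properties that determine it. -/
def opXp {q : ℝ} (hq : q ∈ Set.Ioo (0 : ℝ) 1) : Module.End ℂ (Pol q) :=
  corner (polLift _ (isQuantumSL2_Xp hq))

/-- The action of `X⁻`; see `opXm_gen` and `opXm_mul` for the properties that determine it. -/
def opXm {q : ℝ} (hq : q ∈ Set.Ioo (0 : ℝ) 1) : Module.End ℂ (Pol q) :=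
  corner (polLift _ (isQuantumSL2_Xm hq))

theorem opK_gen {q : ℝ} (hq : q ∈ Set.Ioo (0 : ℝ) 1) (g : TGen) :
    opK hq (tPol q g) = qh q ^ wt g • tPol q g := by
  rw [opK, scaleAlg, polLift_tPol]

theorem opKinv_gen {q : ℝ} (hq : q ∈ Set.Ioo (0 : ℝ) 1) (g : TGen) :
    opKinv hq (tPol q g) = (qh q)⁻¹ ^ wt g • tPol q g := by
  rw [opKinv, scaleAlg, polLift_tPol]

theorem opH_gen (q : ℝ) (g : TGen) : opH q (tPol q g) = ((wt g : ℤ) : ℂ) • tPol q g := by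
  rw [opH, corner_apply, polLift_tPol]; rfl

theorem opXp_gen {q : ℝ} (hq : q ∈ Set.Ioo (0 : ℝ) 1) (g : TGen) :
    opXp hq (tPol q g) = XpGen q g := by
  rw [opXp, corner_apply, polLift_tPol]; rfl

theorem opXm_gen {q : ℝ} (hq : q ∈ Set.Ioo (0 : ℝ) 1) (g : TGen) :
    opXm hq (tPol q g) = XmGen q g := by
  rw [opXm, corner_apply, polLift_tPol]; rfl

theorem triangular_diag {q : ℝ} (a d b : TGen → Pol q)
    (h : IsQuantumSL2 q (fun g => !![a g, d g; 0, b g])) (α β : Pol q →ₐ[ℂ] Pol q)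
    (hα : ∀ g, α (tPol q g) = a g) (hβ : ∀ g, β (tPol q g) = b g) (f : Pol q) :
    polLift _ h f 0 0 = α f ∧ polLift _ h f 1 0 = 0 ∧ polLift _ h f 1 1 = β f := by
  induction f using pol_induction with
  | halg c => simp [AlgHom.commutes, Matrix.algebraMap_matrix_apply]
  | hgen g => simp [polLift_tPol, hα, hβ]
  | hmul x y hx hy =>
    simp only [map_mul, Matrix.mul_apply, Fin.sum_univ_two, hx, hy]
    simp
  | hadd x y hx hy =>
    simp only [map_add, Matrix.add_apply, hx, hy]
    simp

theorem corner_algebraMap {q : ℝ} (T : Pol q →ₐ[ℂ] Matrix (Fin 2) (Fin 2) (Pol q)) (c : ℂ) :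
    corner T (algebraMap ℂ _ c) = 0 := by
  rw [corner_apply, AlgHom.commutes]
  simp [Matrix.algebraMap_matrix_apply]

theorem corner_mul {q : ℝ} (T : Pol q →ₐ[ℂ] Matrix (Fin 2) (Fin 2) (Pol q)) (f g : Pol q) :
    corner T (f * g) = corner T f * T g 1 1 + T f 0 0 * corner T g := by
  rw [corner_apply, map_mul, Matrix.mul_apply, Fin.sum_univ_two, add_comm]; rfl

/-- `H(fg) = Hf · g + f · Hg`, as `Δ(H) = H ⊗ 1 + 1 ⊗ H`. -/
theorem opH_mul (q : ℝ) (f g : Pol q) : opH q (f * g) = opH q f * g + f * opH q g := by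
  have h := triangular_diag _ _ _ (isQuantumSL2_H q) (AlgHom.id ℂ _) (AlgHom.id ℂ _)
    (fun _ => rfl) (fun _ => rfl)
  rw [opH, corner_mul, (h f).1, (h g).2.2]; rfl

/-- `X⁺(fg) = X⁺f · k⁻¹g + kf · X⁺g`, as
`Δ(X⁺) = X⁺ ⊗ e^{hH/4} + e^{-hH/4} ⊗ X⁺`. -/
theorem opXp_mul {q : ℝ} (hq : q ∈ Set.Ioo (0 : ℝ) 1) (f g : Pol q) :
    opXp hq (f * g) = opXp hq f * opKinv hq g + opK hq f * opXp hq g := by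
  have h := triangular_diag _ _ _ (isQuantumSL2_Xp hq) (opK hq) (opKinv hq)
    (opK_gen hq) (opKinv_gen hq)
  rw [opXp, corner_mul, (h f).1, (h g).2.2]

/-- `X⁻(fg) = X⁻f · k⁻¹g + kf · X⁻g`, as
`Δ(X⁻) = X⁻ ⊗ e^{hH/4} + e^{-hH/4} ⊗ X⁻`. -/
theorem opXm_mul {q : ℝ} (hq : q ∈ Set.Ioo (0 : ℝ) 1) (f g : Pol q) :
    opXm hq (f * g) = opXm hq f * opKinv hq g + opK hq f * opXm hq g := by
  have h := triangular_diag _ _ _ (isQuantumSL2_Xm hq) (opK hq) (opKinv hq)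
    (opK_gen hq) (opKinv_gen hq)
  rw [opXm, corner_mul, (h f).1, (h g).2.2]

theorem opH_algebraMap (q : ℝ) (c : ℂ) : opH q (algebraMap ℂ _ c) = 0 := corner_algebraMap _ c

theorem opXp_algebraMap {q : ℝ} (hq : q ∈ Set.Ioo (0 : ℝ) 1) (c : ℂ) :
    opXp hq (algebraMap ℂ _ c) = 0 := corner_algebraMap _ c

theorem opXm_algebraMap {q : ℝ} (hq : q ∈ Set.Ioo (0 : ℝ) 1) (c : ℂ) :
    opXm hq (algebraMap ℂ _ c) = 0 := corner_algebraMap _ c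

theorem opK_opKinv {q : ℝ} (hq : q ∈ Set.Ioo (0 : ℝ) 1) (f : Pol q) :
    opK hq (opKinv hq f) = f := by
  induction f using pol_induction with
  | halg c => rw [AlgHom.commutes, AlgHom.commutes]
  | hgen g =>
    have h0 := zpow_ne_zero (wt g) (qh_ne_zero hq)
    simp only [opK_gen, opKinv_gen, map_smul, inv_zpow, smul_smul, inv_mul_cancel₀ h0, one_smul]
  | hmul x y hx hy => rw [map_mul, map_mul, hx, hy]
  | hadd x y hx hy => rw [map_add, map_add, hx, hy]

theorem opKinv_opK {q : ℝ} (hq : q ∈ Set.Ioo (0 : ℝ) 1) (f : Pol q) :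
    opKinv hq (opK hq f) = f := by
  induction f using pol_induction with
  | halg c => rw [AlgHom.commutes, AlgHom.commutes]
  | hgen g =>
    have h0 := zpow_ne_zero (wt g) (qh_ne_zero hq)
    simp only [opK_gen, opKinv_gen, map_smul, inv_zpow, smul_smul, mul_inv_cancel₀ h0, one_smul]
  | hmul x y hx hy => rw [map_mul, map_mul, hx, hy]
  | hadd x y hx hy => rw [map_add, map_add, hx, hy]

theorem opK_opH {q : ℝ} (hq : q ∈ Set.Ioo (0 : ℝ) 1) (f : Pol q) :
    opK hq (opH q f) = opH q (opK hq f) := by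
  induction f using pol_induction with
  | halg c => rw [AlgHom.commutes, opH_algebraMap, map_zero]
  | hgen g => simp only [opK_gen, opH_gen, map_smul, smul_smul, mul_comm]
  | hmul x y hx hy => simp only [map_mul, opH_mul, map_add, hx, hy]
  | hadd x y hx hy => simp only [map_add, hx, hy]

theorem opKinv_opH {q : ℝ} (hq : q ∈ Set.Ioo (0 : ℝ) 1) (f : Pol q) :
    opKinv hq (opH q f) = opH q (opKinv hq f) := by
  have h := opK_opH hq (opKinv hq f)
  rw [opK_opKinv] at h
  rw [← h, opKinv_opK]

theorem opK_opXp {q : ℝ} (hq : q ∈ Set.Ioo (0 : ℝ) 1) (f : Pol q) :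
    opK hq (opXp hq f) = (q : ℂ) • opXp hq (opK hq f) := by
  have h0 := qh_ne_zero hq
  induction f using pol_induction with
  | halg c => rw [AlgHom.commutes, opXp_algebraMap, map_zero, smul_zero]
  | hgen g =>
    rw [qh_mul_self hq]
    cases g <;> simp only [opXp_gen, opK_gen, XpGen, wt, map_zero, map_smul, smul_zero] <;>
      match_scalars <;> simp [h0]
  | hmul x y hx hy =>
    simp only [map_mul, opXp_mul, map_add, hx, hy, opK_opKinv, opKinv_opK, smul_add,
      smul_mul_assoc, mul_smul_comm]
  | hadd x y hx hy => simp only [map_add, hx, hy, smul_add]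

theorem opK_opXm {q : ℝ} (hq : q ∈ Set.Ioo (0 : ℝ) 1) (f : Pol q) :
    opK hq (opXm hq f) = (q : ℂ)⁻¹ • opXm hq (opK hq f) := by
  have h0 := qh_ne_zero hq
  induction f using pol_induction with
  | halg c => rw [AlgHom.commutes, opXm_algebraMap, map_zero, smul_zero]
  | hgen g =>
    rw [qh_mul_self hq]
    cases g <;> simp only [opXm_gen, opK_gen, XmGen, wt, map_zero, map_smul, smul_zero] <;>
      match_scalars <;> simp [h0]
  | hmul x y hx hy =>
    simp only [map_mul, opXm_mul, map_add, hx, hy, opK_opKinv, opKinv_opK, smul_add,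
      smul_mul_assoc, mul_smul_comm]
  | hadd x y hx hy => simp only [map_add, hx, hy, smul_add]

theorem opKinv_opXp {q : ℝ} (hq : q ∈ Set.Ioo (0 : ℝ) 1) (f : Pol q) :
    opKinv hq (opXp hq f) = (q : ℂ)⁻¹ • opXp hq (opKinv hq f) := by
  have hq0 : (q : ℂ) ≠ 0 := by exact_mod_cast hq.1.ne'
  have h := congrArg (opKinv hq) (opK_opXp hq (opKinv hq f))
  rw [opKinv_opK, opK_opKinv, map_smul] at h
  rw [h, smul_smul, inv_mul_cancel₀ hq0, one_smul]

theorem opKinv_opXm {q : ℝ} (hq : q ∈ Set.Ioo (0 : ℝ) 1) (f : Pol q) :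
    opKinv hq (opXm hq f) = (q : ℂ) • opXm hq (opKinv hq f) := by
  have hq0 : (q : ℂ) ≠ 0 := by exact_mod_cast hq.1.ne'
  have h := congrArg (opKinv hq) (opK_opXm hq (opKinv hq f))
  rw [opKinv_opK, opK_opKinv, map_smul] at h
  rw [h, smul_smul, mul_inv_cancel₀ hq0, one_smul]

theorem opH_opXp {q : ℝ} (hq : q ∈ Set.Ioo (0 : ℝ) 1) (f : Pol q) :
    opH q (opXp hq f) = opXp hq (opH q f) + (2 : ℂ) • opXp hq f := by
  induction f using pol_induction with
  | halg c => simp only [opH_algebraMap, opXp_algebraMap, map_zero, smul_zero, add_zero]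
  | hgen g =>
    cases g <;> simp only [opXp_gen, opH_gen, XpGen, wt, map_zero, map_smul, smul_zero] <;>
      match_scalars <;> norm_num
  | hmul x y hx hy =>
    simp only [opH_mul, opXp_mul, map_add, hx, hy, opK_opH, opKinv_opH, add_mul, mul_add,
      smul_mul_assoc, mul_smul_comm]
    module
  | hadd x y hx hy => simp only [map_add, hx, hy]; module

theorem opH_opXm {q : ℝ} (hq : q ∈ Set.Ioo (0 : ℝ) 1) (f : Pol q) :
    opH q (opXm hq f) = opXm hq (opH q f) + (-2 : ℂ) • opXm hq f := by
  induction f using pol_induction with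
  | halg c => simp only [opH_algebraMap, opXm_algebraMap, map_zero, smul_zero, add_zero]
  | hgen g =>
    cases g <;> simp only [opXm_gen, opH_gen, XmGen, wt, map_zero, map_smul, smul_zero] <;>
      match_scalars <;> norm_num
  | hmul x y hx hy =>
    simp only [opH_mul, opXm_mul, map_add, hx, hy, opK_opH, opKinv_opH, add_mul, mul_add,
      smul_mul_assoc, mul_smul_comm]
    module
  | hadd x y hx hy => simp only [map_add, hx, hy]; module

theorem opXp_opXm {q : ℝ} (hq : q ∈ Set.Ioo (0 : ℝ) 1) (f : Pol q) :
    opXp hq (opXm hq f) = opXm hq (opXp hq f) +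
      ((q : ℂ) - (q : ℂ)⁻¹)⁻¹ • (opK hq (opK hq f) - opKinv hq (opKinv hq f)) := by
  have h0 := qh_ne_zero hq
  have hq0 : (q : ℂ) ≠ 0 := by exact_mod_cast hq.1.ne'
  have hne : (q : ℂ) - (q : ℂ)⁻¹ ≠ 0 := by
    have h1 : q - q⁻¹ < 0 := by
      have := (one_lt_inv₀ hq.1).mpr hq.2
      linarith [hq.2]
    exact_mod_cast h1.ne
  induction f using pol_induction with
  | halg c =>
    simp only [AlgHom.commutes, opXp_algebraMap, opXm_algebraMap, map_zero, sub_self, smul_zero,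
      add_zero]
  | hgen g =>
    cases g <;> simp only [opXm_gen, opXp_gen, opK_gen, opKinv_gen, XmGen, XpGen, wt, map_zero,
      map_smul, zpow_one, zpow_neg, smul_smul, ← sub_smul, inv_inv, ← mul_inv,
      ← qh_mul_self hq, inv_mul_cancel₀ hne]
    · simp
    · rw [← neg_sub (q : ℂ), mul_neg, inv_mul_cancel₀ hne]; simp
    · simp
    · rw [← neg_sub (q : ℂ), mul_neg, inv_mul_cancel₀ hne]; simp
  | hmul x y hx hy =>
    simp only [opXp_mul, opXm_mul, map_add, map_mul, hx, hy, opK_opXp, opK_opXm, opKinv_opXp,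
      opKinv_opXm, add_mul, mul_add, smul_mul_assoc, mul_smul_comm, mul_sub, sub_mul]
    module
  | hadd x y hx hy => simp only [map_add, hx, hy]; module

/-- The values on generators of the representation of `U_q su(1,1)` in `Pol(X̃)_q`. -/
def polActionGen {q : ℝ} (hq : q ∈ Set.Ioo (0 : ℝ) 1) : UGen → Module.End ℂ (Pol q)
  | .H => opH q
  | .Xp => opXp hq
  | .Xm => opXm hq
  | .k => (opK hq).toLinearMap
  | .kinv => (opKinv hq).toLinearMap

/-- The representation of `U_q su(1,1)` in `Pol(X̃)_q`. -/
def polAction {q : ℝ} (hq : q ∈ Set.Ioo (0 : ℝ) 1) : Uq q →ₐ[ℂ] Module.End ℂ (Pol q) :=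
  RingQuot.liftAlgHom ℂ ⟨FreeAlgebra.lift ℂ (polActionGen hq), by
    intro x y h
    cases h <;> simp only [map_mul, map_sub, map_smul, map_pow, map_one,
      FreeAlgebra.lift_ι_apply, polActionGen] <;> refine LinearMap.ext fun f => ?_
    · exact opK_opKinv hq f
    · exact opKinv_opK hq f
    · exact opK_opH hq f
    · exact opK_opXp hq f
    · exact opK_opXm hq f
    · exact sub_eq_of_eq_add' (opH_opXp hq f)
    · exact sub_eq_of_eq_add' (opH_opXm hq f)
    · rw [sq, sq]; exact sub_eq_of_eq_add' (opXp_opXm hq f)⟩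

/-! ### Distributions, finite functions and the integral -/

/-- The index set `M''` of quadruples `(i₁, i₂, j₁, j₂)` with `i₁ j₁ = i₂ j₂ = 0`. -/
structure Idx where
  i₁ : ℕ
  i₂ : ℕ
  j₁ : ℕ
  j₂ : ℕ
  h₁ : i₁ * j₁ = 0
  h₂ : i₂ * j₂ = 0

/-- The element `t₁₁* = -t₂₂`. -/
def t11star (q : ℝ) : Pol q := -tPol q .t22

/-- The element `t₁₂* = -q t₂₁`. -/
def t12star (q : ℝ) : Pol q := -((q : ℂ) • tPol q .t21)

/-- The element `x = t₁₂ t₁₂*`. -/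
def xPol (q : ℝ) : Pol q := tPol q .t12 * t12star q

/-- The element `∑ t₁₁^{i₁} t₁₂^{i₂} ψ_{i₁i₂j₁j₂}(x) t₁₂*^{j₂} t₁₁*^{j₁}` of `Pol(X̃)_q`, for a
finitely supported family of polynomials `ψ` indexed by `M''`. -/
def expand (q : ℝ) (ψ : Idx →₀ Polynomial ℂ) : Pol q :=
  ψ.sum fun i p => tPol q .t11 ^ i.i₁ * tPol q .t12 ^ i.i₂ * Polynomial.aeval (xPol q) p *
    t12star q ^ i.j₂ * t11star q ^ i.j₁

/-- The space of distributions `D(X̃)_q'`: formal series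
`∑ t₁₁^{i₁} t₁₂^{i₂} ψ_{i₁i₂j₁j₂}(x) t₁₂*^{j₂} t₁₁*^{j₁}` whose coefficients are functions on
`q^{-2ℤ₊}`, with the topology of pointwise convergence of the coefficients. Such a series is stored
as the family of numbers `f i m = ψ_i(q^{-2m})`. -/
abbrev Distr : Type := Idx → ℕ → ℂ

/-- The formal series with polynomial coefficients `ψ`; this is the element `expand q ψ` of
`Pol(X̃)_q`, regarded as a distribution. -/
def toDistr (q : ℝ) (ψ : Idx →₀ Polynomial ℂ) : Distr :=
  fun i m => (ψ i).eval (((q : ℂ) ^ (2 * m))⁻¹)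

/-- A representation of `U_q su(1,1)` by continuous operators in `D(X̃)_q'` extends by continuity
the one in `Pol(X̃)_q` if it agrees with it on the image of `Pol(X̃)_q`. -/
def ExtendsPolAction {q : ℝ} (hq : q ∈ Set.Ioo (0 : ℝ) 1) (ρ : Uq q →ₐ[ℂ] (Distr →L[ℂ] Distr)) :
    Prop :=
  ∀ (ξ : Uq q) (ψ φ : Idx →₀ Polynomial ℂ),
    polAction hq ξ (expand q ψ) = expand q φ → ρ ξ (toDistr q ψ) = toDistr q φ

/-- The space `D(X̃)_q` of finite functions: only finitely many numbers `ψ_i(q^{-2m})` are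
nonzero. -/
def FinFun : Submodule ℂ Distr where
  carrier := {f | {p : Idx × ℕ | f p.1 p.2 ≠ 0}.Finite}
  zero_mem' := by simp
  add_mem' := by
    intro f g hf hg
    refine (hf.union hg).subset fun p hp => ?_
    by_contra h
    simp only [Set.mem_union, Set.mem_ofPred_eq, not_or, not_not] at h
    exact hp (by simp [h.1, h.2])
  smul_mem' := by
    intro c f hf
    refine hf.subset fun p hp h => hp ?_
    simp [h]

/-- The index `(0,0,0,0)`. -/
def idx0 : Idx := ⟨0, 0, 0, 0, rfl, rfl⟩

theorem summable_coeff (q : ℝ) (f : FinFun) :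
    Summable fun m : ℕ => (f : Distr) idx0 m * ((q : ℂ) ^ (2 * m))⁻¹ := by
  refine summable_of_hasFiniteSupport ?_
  refine (f.2.preimage (f := fun m : ℕ => (idx0, m)) (fun a _ b _ h => by simpa using h)).subset ?_
  intro m hm h
  exact hm (by simp [h])

/-- The linear functional `f ↦ (1 - q²) ∑_{m ≥ 0} ψ_{0000}(q^{-2m}) q^{-2m}` on `D(X̃)_q` (the sum
has finitely many nonzero terms). -/
def nu (q : ℝ) : FinFun →ₗ[ℂ] ℂ where
  toFun f := (1 - (q : ℂ) ^ 2) * ∑' m : ℕ, (f : Distr) idx0 m * ((q : ℂ) ^ (2 * m))⁻¹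
  map_add' f g := by
    rw [← mul_add, ← (summable_coeff q f).tsum_add (summable_coeff q g)]
    simp [add_mul]
  map_smul' c f := by
    simp only [Submodule.coe_smul, Pi.smul_apply, smul_eq_mul, mul_assoc, tsum_mul_left,
      RingHom.id_apply]
    ring

end QuantumSU11

end

/-
A distribution is a matrix over `ℕ × ℕ` with entries in the formal series in a phase, and the
generators of `Pol(X̃)_q` multiply such matrices on the left: `t₁₂` and `t₂₁` act diagonally,
`t₁₁` and `t₂₂` shift the rows. There `t₁₂` and `t₂₁` are invertible, and this makes `X⁺` and `X⁻`
inner: they are twisted commutators with `t₁₁ t₁₂⁻¹` and `t₂₂ t₂₁⁻¹`, which makes sense for every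
matrix and is continuous. Polynomials are dense by interpolation at the points `q^{-2m}`; hence the
operators so obtained satisfy the relations of `U_q su(1,1)`, and the extension is unique. The
integral is a quantum trace, whose value on a twisted commutator is a telescoping sum.
-/

noncomputable section

namespace QuantumSU11

/-! ### The matrix model of distributions -/

/-- The weighted composition operator `F ↦ w · (F ∘ σ)`. -/
def weightedComp {X : Type*} (w : X → ℂ) (σ : X → X) : Module.End ℂ (X → ℂ) where
  toFun F x := w x * F (σ x)
  map_add' F G := funext fun x => mul_add (w x) (F (σ x)) (G (σ x))
  map_smul' a F := funext fun x => mul_left_comm (w x) a (F (σ x))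

theorem weightedComp_apply {X : Type*} (w : X → ℂ) (σ : X → X) (F : X → ℂ) (x : X) :
    weightedComp w σ F x = w x * F (σ x) := rfl

theorem ofReal_ne_zero_of_mem_Ioo {q : ℝ} (hq : q ∈ Set.Ioo (0 : ℝ) 1) : (q : ℂ) ≠ 0 :=
  Complex.ofReal_ne_zero.mpr hq.1.ne'

theorem pow_ne_one_of_mem_Ioo {q : ℝ} (hq : q ∈ Set.Ioo (0 : ℝ) 1) {n : ℕ} (hn : n ≠ 0) :
    (q : ℂ) ^ n ≠ 1 := by
  exact_mod_cast (pow_lt_one₀ hq.1.le hq.2 hn).ne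

/-- Matrices over `ℕ × ℕ` whose entries are formal series in the integral powers of a phase:
`F (r, c, b)` is the coefficient of the `b`-th power of the phase in row `r` and column `c`. -/
abbrev PhaseMat : Type := ℕ × ℕ × ℤ → ℂ

/-- The value of `t₁₁ t₁₁* = x - 1` at `x = q^{-2r}`. -/
def shiftCoeff (q : ℝ) (r : ℕ) : ℂ := ((q : ℂ) ^ (2 * r))⁻¹ - 1

theorem shiftCoeff_zero (q : ℝ) : shiftCoeff q 0 = 0 := by simp [shiftCoeff]

theorem shiftCoeff_succ_ne_zero {q : ℝ} (hq : q ∈ Set.Ioo (0 : ℝ) 1) (r : ℕ) :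
    shiftCoeff q (r + 1) ≠ 0 :=
  sub_ne_zero.mpr <| inv_ne_one.mpr <| pow_ne_one_of_mem_Ioo hq <| by omega

/-- Left multiplication of matrices by the generators of `Pol(X̃)_q`: `t₁₂` and `t₁₂* = -q t₂₁` are
diagonal with opposite phases, while `t₁₁` and `t₁₁* = -t₂₂` shift the rows. -/
def leftMul (q : ℝ) : TGen → Module.End ℂ PhaseMat
  | .t11 => weightedComp (fun (r, _, _) => shiftCoeff q r) fun (r, c, b) => (r - 1, c, b)
  | .t12 => weightedComp (fun (r, _, _) => ((q : ℂ) ^ r)⁻¹) fun (r, c, b) => (r, c, b - 1)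
  | .t21 => weightedComp (fun (r, _, _) => -((q : ℂ) ^ (r + 1))⁻¹) fun (r, c, b) => (r, c, b + 1)
  | .t22 => weightedComp (fun _ => -1) fun (r, c, b) => (r + 1, c, b)

theorem isQuantumSL2_leftMul {q : ℝ} (hq : q ∈ Set.Ioo (0 : ℝ) 1) :
    IsQuantumSL2 q (leftMul q) := by
  have hq0 := ofReal_ne_zero_of_mem_Ioo hq
  constructor <;> ext F ⟨r, c, b⟩ <;> rcases r with _ | r <;>
    simp only [leftMul, weightedComp_apply, Module.End.mul_apply, LinearMap.smul_apply,
      LinearMap.sub_apply, Pi.sub_apply, Pi.smul_apply, smul_eq_mul, Module.End.one_apply,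
      Nat.add_sub_cancel, mul_zero, sub_add_cancel, add_sub_cancel_right, Nat.zero_sub, zero_add,
      shiftCoeff, inv_one, pow_zero, ← mul_assoc] <;>
    field_simp
  all_goals ring

/-- The representation of `Pol(X̃)_q` by left multiplication of matrices. -/
def matRep {q : ℝ} (hq : q ∈ Set.Ioo (0 : ℝ) 1) : Pol q →ₐ[ℂ] Module.End ℂ PhaseMat :=
  polLift (leftMul q) (isQuantumSL2_leftMul hq)

theorem matRep_tPol {q : ℝ} (hq : q ∈ Set.Ioo (0 : ℝ) 1) (t : TGen) :
    matRep hq (tPol q t) = leftMul q t := polLift_tPol _ _ t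

/-- The normalising constant `(q^{-2} - 1)^{-1}` of `X^±`. -/
def kappa (q : ℝ) : ℂ := (((q : ℂ) ^ 2)⁻¹ - 1)⁻¹

theorem kappa_mul_inv_sq_sub_one {q : ℝ} (hq : q ∈ Set.Ioo (0 : ℝ) 1) :
    kappa q * (((q : ℂ) ^ 2)⁻¹ - 1) = 1 :=
  inv_mul_cancel₀ <| sub_ne_zero.mpr <| inv_ne_one.mpr <| pow_ne_one_of_mem_Ioo hq two_ne_zero

/-- Left multiplication by the inverse of `t₁₂`, which exists because the phase is invertible. -/
def leftMulInv12 (q : ℝ) : Module.End ℂ PhaseMat :=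
  weightedComp (fun (r, _, _) => (q : ℂ) ^ r) fun (r, c, b) => (r, c, b + 1)

/-- Left multiplication by the inverse of `t₂₁`. -/
def leftMulInv21 (q : ℝ) : Module.End ℂ PhaseMat :=
  weightedComp (fun (r, _, _) => -(q : ℂ) ^ (r + 1)) fun (r, c, b) => (r, c, b - 1)

/-- Right multiplication of matrices by `t₁₁ t₁₂⁻¹`. -/
def rightMulXp (q : ℝ) : Module.End ℂ PhaseMat :=
  weightedComp (fun (_, c, _) => (q : ℂ) ^ c) fun (r, c, b) => (r, c + 1, b + 1)

/-- Right multiplication of matrices by `t₂₂ t₂₁⁻¹`. -/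
def rightMulXm (q : ℝ) : Module.End ℂ PhaseMat :=
  weightedComp (fun (_, c, _) => (q : ℂ) ^ (c + 1) * shiftCoeff q c)
    fun (r, c, b) => (r, c - 1, b - 1)

/-- The operator that multiplies the matrix entries of weight `n` by `a ^ n`. The weight of the
entry `(r, c, b)` is `r - c - b`, as `t₁₁` and `t₂₁` have weight `1` and lower `b` or raise `r`. -/
def scaleMat (a : ℂ) : Module.End ℂ PhaseMat :=
  weightedComp (fun (r, c, b) => a ^ (r - c - b : ℤ)) id

/-- The operators on matrices that correspond to the generators of `U_q su(1,1)`. With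
`y = t₁₁ t₁₂⁻¹`, `z = t₂₂ t₂₁⁻¹` and `κ = kappa q`, the operators of `X⁺` and `X⁻` are the twisted
commutators `F ↦ κ (q^{-3/2} k (F y) - q^{1/2} k⁻¹ (y F))` and
`F ↦ κ (q^{-5/2} k⁻¹ (z F) - q^{-1/2} k (F z))`. -/
def matAction (q : ℝ) : UGen → Module.End ℂ PhaseMat
  | .H => weightedComp (fun (r, c, b) => r - c - b) id
  | .Xp => (kappa q * (qh q ^ 3)⁻¹) • (scaleMat (qh q) * rightMulXp q) +
      (-(kappa q * qh q)) • (scaleMat (qh q)⁻¹ * (leftMul q .t11 * leftMulInv12 q))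
  | .Xm => (-(kappa q * (qh q)⁻¹)) • (scaleMat (qh q) * rightMulXm q) +
      (kappa q * (qh q ^ 5)⁻¹) • (scaleMat (qh q)⁻¹ * (leftMul q .t22 * leftMulInv21 q))
  | .k => scaleMat (qh q)
  | .kinv => scaleMat (qh q)⁻¹

/-! ### Twisted Leibniz rules -/

theorem semilinear_of_generators {q : ℝ} {A : Type*} [Ring A] [Algebra ℂ A] (π : Pol q →ₐ[ℂ] A)
    (α : Pol q →ₐ[ℂ] Pol q) {B : A}
    (hgen : ∀ g, B * π (tPol q g) = π (α (tPol q g)) * B) (f : Pol q) :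
    B * π f = π (α f) * B := by
  induction f using pol_induction with
  | halg c =>
    rw [AlgHom.commutes, AlgHom.commutes, AlgHom.commutes]
    exact (Algebra.commutes c B).symm
  | hgen g => exact hgen g
  | hmul x y hx hy => rw [map_mul, ← mul_assoc, hx, mul_assoc, hy, map_mul, map_mul, mul_assoc]
  | hadd x y hx hy => simp only [map_add, mul_add, add_mul, hx, hy]

theorem twisted_leibniz_of_generators {q : ℝ} {A : Type*} [Ring A] [Algebra ℂ A]
    (π : Pol q →ₐ[ℂ] A) (α β : Pol q →ₐ[ℂ] Pol q) (d : Module.End ℂ (Pol q))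
    (hmul : ∀ f g, d (f * g) = d f * β g + α f * d g)
    {B D : A} (hB : ∀ f, B * π f = π (β f) * B)
    (hgen : ∀ g, D * π (tPol q g) = π (d (tPol q g)) * B + π (α (tPol q g)) * D) (f : Pol q) :
    D * π f = π (d f) * B + π (α f) * D := by
  have hd : d 1 = 0 := by simpa using hmul 1 1
  induction f using pol_induction with
  | halg c =>
    rw [Algebra.algebraMap_eq_smul_one, map_smul d, hd, smul_zero, map_zero, zero_mul, zero_add,
      ← Algebra.algebraMap_eq_smul_one, AlgHom.commutes, AlgHom.commutes, AlgHom.commutes]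
    exact (Algebra.commutes c D).symm
  | hgen g => exact hgen g
  | hmul x y hx hy =>
    rw [map_mul, ← mul_assoc, hx, add_mul, mul_assoc, hB, mul_assoc, hy, hmul, map_add, map_mul,
      map_mul, map_mul, map_mul]
    noncomm_ring
  | hadd x y hx hy => simp only [map_add, mul_add, add_mul, hx, hy]; abel

theorem twisted_commutator_mul {A : Type*} [Ring A] [Algebra ℂ A] {k k' R L t e : A}
    {w a b : ℂ} (hw : w ≠ 0) (hk : k * t = w • (t * k)) (hk' : k' * t = w⁻¹ • (t * k'))
    (hR : Commute R t) (hL : b • (k' * (L * t - w ^ 2 • (t * L))) = e * k') :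
    (a • (k * R) + b • (k' * L)) * t = e * k' + w • (t * (a • (k * R) + b • (k' * L))) := by
  have h1 : k * R * t = w • (t * (k * R)) := by
    rw [mul_assoc, hR.eq, ← mul_assoc, hk, smul_mul_assoc, mul_assoc]
  have h2 : w • (t * (k' * L)) = w ^ 2 • (k' * (t * L)) := by
    rw [← mul_assoc, ← mul_assoc, hk', smul_mul_assoc, smul_smul, sq, mul_assoc w,
      mul_inv_cancel₀ hw, mul_one]
  rw [add_mul, smul_mul_assoc, smul_mul_assoc, h1, mul_add, smul_add, mul_smul_comm,
    mul_smul_comm, smul_comm w a, smul_comm w b, h2, ← hL, mul_sub, smul_sub, mul_smul_comm,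
    mul_assoc k']
  abel

theorem inv_mul_eq_smul_of_mul_eq_smul {A : Type*} [Ring A] [Algebra ℂ A] {u v x : A} {c : ℂ}
    (h1 : u * v = 1) (h2 : v * u = 1) (h : x * u = c • (u * x)) : v * x = c • (x * v) := by
  calc v * x = v * (x * u) * v := by rw [mul_assoc, mul_assoc x, h1, mul_one]
    _ = c • (x * v) := by rw [h, mul_smul_comm, smul_mul_assoc, ← mul_assoc, h2, one_mul]

section RatioCommutators

variable {q : ℝ} {A : Type*} [Ring A] [Algebra ℂ A] {t : TGen → A} {v : A}

theorem t11_mul_inv_commutator (hq : q ∈ Set.Ioo (0 : ℝ) 1) (ht : IsQuantumSL2 q t)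
    (h1 : t .t12 * v = 1) (h2 : v * t .t12 = 1) (g : TGen) :
    t .t11 * v * t g - (q : ℂ) ^ wt g • (t g * (t .t11 * v)) =
      (1 - ((q : ℂ) ^ 2)⁻¹) • polLift t ht (XpGen q g) := by
  have hq0 := ofReal_ne_zero_of_mem_Ioo hq
  have h11 : v * t .t11 = (q : ℂ) • (t .t11 * v) := inv_mul_eq_smul_of_mul_eq_smul h1 h2 ht.r1
  have h21 : v * t .t21 = t .t21 * v := by
    simpa using inv_mul_eq_smul_of_mul_eq_smul (c := 1) h1 h2 (by rw [one_smul, ht.r5])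
  have h22 : v * t .t22 = (q : ℂ)⁻¹ • (t .t22 * v) :=
    inv_mul_eq_smul_of_mul_eq_smul h1 h2 (by rw [ht.r4, inv_smul_smul₀ hq0])
  cases g
  · simp [wt, XpGen, mul_assoc, h11]
  · calc t .t11 * v * t .t12 - (q : ℂ) ^ wt .t12 • (t .t12 * (t .t11 * v))
        = t .t11 - (q : ℂ)⁻¹ • (t .t12 * t .t11 * v) := by
          rw [mul_assoc, h2, mul_one, ← mul_assoc, wt, zpow_neg_one]
      _ = t .t11 - (q : ℂ)⁻¹ • (q : ℂ)⁻¹ • (t .t11 * (t .t12 * v)) := by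
          rw [← inv_smul_smul₀ hq0 (t .t12 * t .t11), ← ht.r1, smul_mul_assoc, mul_assoc]
      _ = _ := by rw [h1, mul_one, XpGen, polLift_tPol]; match_scalars; field_simp
  · rw [mul_assoc, h21, ← mul_assoc, ht.r3, wt, XpGen, map_zero, smul_zero, zpow_one,
      smul_mul_assoc, mul_assoc, sub_self]
  · calc t .t11 * v * t .t22 - (q : ℂ) ^ wt .t22 • (t .t22 * (t .t11 * v))
        = (q : ℂ)⁻¹ • ((t .t11 * t .t22 - t .t22 * t .t11) * v) := by
          rw [mul_assoc, h22, wt, zpow_neg_one, mul_smul_comm, ← smul_sub, sub_mul, mul_assoc,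
            mul_assoc]
      _ = (q : ℂ)⁻¹ • ((q : ℂ) - (q : ℂ)⁻¹) • (t .t21 * (t .t12 * v)) := by
          rw [ht.r6, ht.r5, smul_mul_assoc, mul_assoc]
      _ = _ := by rw [h1, mul_one, XpGen, polLift_tPol]; match_scalars; field_simp

theorem t22_mul_inv_commutator (hq : q ∈ Set.Ioo (0 : ℝ) 1) (ht : IsQuantumSL2 q t)
    (h1 : t .t21 * v = 1) (h2 : v * t .t21 = 1) (g : TGen) :
    t .t22 * v * t g - (q : ℂ) ^ wt g • (t g * (t .t22 * v)) =
      (1 - (q : ℂ) ^ 2) • polLift t ht (XmGen q g) := by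
  have hq0 := ofReal_ne_zero_of_mem_Ioo hq
  have h11 : v * t .t11 = (q : ℂ) • (t .t11 * v) := inv_mul_eq_smul_of_mul_eq_smul h1 h2 ht.r3
  have h12 : v * t .t12 = t .t12 * v := by
    simpa using inv_mul_eq_smul_of_mul_eq_smul (c := 1) h1 h2 (by rw [one_smul, ht.r5])
  have h22 : v * t .t22 = (q : ℂ)⁻¹ • (t .t22 * v) :=
    inv_mul_eq_smul_of_mul_eq_smul h1 h2 (by rw [ht.r2, inv_smul_smul₀ hq0])
  cases g
  · calc t .t22 * v * t .t11 - (q : ℂ) ^ wt .t11 • (t .t11 * (t .t22 * v))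
        = -(q : ℂ) • ((t .t11 * t .t22 - t .t22 * t .t11) * v) := by
          rw [mul_assoc, h11, wt, zpow_one, mul_smul_comm, sub_mul, mul_assoc, mul_assoc]
          module
      _ = -(q : ℂ) • ((q : ℂ) - (q : ℂ)⁻¹) • (t .t12 * (t .t21 * v)) := by
          rw [ht.r6, smul_mul_assoc, mul_assoc]
      _ = _ := by rw [h1, mul_one, XmGen, polLift_tPol]; match_scalars; field_simp; ring
  · rw [mul_assoc, h12, ← mul_assoc, ← mul_assoc, ht.r4, wt, XmGen, map_zero, smul_zero,
      zpow_neg_one, smul_mul_assoc, inv_smul_smul₀ hq0, sub_self]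
  · calc t .t22 * v * t .t21 - (q : ℂ) ^ wt .t21 • (t .t21 * (t .t22 * v))
        = t .t22 - (q : ℂ) • (t .t21 * t .t22 * v) := by
          rw [mul_assoc, h2, mul_one, ← mul_assoc, wt, zpow_one]
      _ = t .t22 - (q : ℂ) • (q : ℂ) • (t .t22 * (t .t21 * v)) := by
          rw [ht.r2, smul_mul_assoc, mul_assoc]
      _ = _ := by rw [h1, mul_one, XmGen, polLift_tPol]; module
  · simp [wt, XmGen, mul_assoc, h22]

end RatioCommutators

theorem leftMul_t12_mul_inv {q : ℝ} (hq : q ∈ Set.Ioo (0 : ℝ) 1) :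
    leftMul q .t12 * leftMulInv12 q = 1 := by
  have hq0 := ofReal_ne_zero_of_mem_Ioo hq
  ext F ⟨r, c, b⟩
  simp [leftMul, leftMulInv12, weightedComp_apply, hq0]

theorem leftMulInv12_mul_t12 {q : ℝ} (hq : q ∈ Set.Ioo (0 : ℝ) 1) :
    leftMulInv12 q * leftMul q .t12 = 1 := by
  have hq0 := ofReal_ne_zero_of_mem_Ioo hq
  ext F ⟨r, c, b⟩
  simp [leftMul, leftMulInv12, weightedComp_apply, hq0]

theorem leftMul_t21_mul_inv {q : ℝ} (hq : q ∈ Set.Ioo (0 : ℝ) 1) :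
    leftMul q .t21 * leftMulInv21 q = 1 := by
  have hq0 := ofReal_ne_zero_of_mem_Ioo hq
  ext F ⟨r, c, b⟩
  simp [leftMul, leftMulInv21, weightedComp_apply, hq0]

theorem leftMulInv21_mul_t21 {q : ℝ} (hq : q ∈ Set.Ioo (0 : ℝ) 1) :
    leftMulInv21 q * leftMul q .t21 = 1 := by
  have hq0 := ofReal_ne_zero_of_mem_Ioo hq
  ext F ⟨r, c, b⟩
  simp [leftMul, leftMulInv21, weightedComp_apply, hq0]

section MatAction

variable {q : ℝ} (hq : q ∈ Set.Ioo (0 : ℝ) 1)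

theorem commute_rightMulXp_leftMul (g : TGen) : Commute (rightMulXp q) (leftMul q g) := by
  ext F ⟨r, c, b⟩
  cases g <;> simp [leftMul, rightMulXp, weightedComp_apply, mul_left_comm]

theorem commute_rightMulXm_leftMul (g : TGen) : Commute (rightMulXm q) (leftMul q g) := by
  ext F ⟨r, c, b⟩
  cases g <;> simp [leftMul, rightMulXm, weightedComp_apply, mul_left_comm]

theorem scaleMat_mul_leftMul {a : ℂ} (ha : a ≠ 0) (g : TGen) :
    scaleMat a * leftMul q g = a ^ wt g • (leftMul q g * scaleMat a) := by
  ext F ⟨r, c, b⟩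
  cases g <;> rcases r with _ | r <;>
    simp only [scaleMat, leftMul, Module.End.mul_apply, LinearMap.smul_apply, Pi.smul_apply,
      smul_eq_mul, weightedComp_apply, id_eq, wt, shiftCoeff_zero, zpow_add₀ ha, zpow_sub₀ ha,
      zpow_neg, zpow_natCast, zpow_one, Nat.add_sub_cancel, zero_mul, mul_zero] <;>
    field_simp <;> ring

theorem scaleMat_mul_matRep (f : Pol q) :
    scaleMat (qh q) * matRep hq f = matRep hq (opK hq f) * scaleMat (qh q) :=
  semilinear_of_generators _ (opK hq) (fun g => by
    rw [opK_gen, map_smul, matRep_tPol, scaleMat_mul_leftMul (qh_ne_zero hq), smul_mul_assoc]) f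

theorem scaleMat_inv_mul_matRep (f : Pol q) :
    scaleMat (qh q)⁻¹ * matRep hq f = matRep hq (opKinv hq f) * scaleMat (qh q)⁻¹ :=
  semilinear_of_generators _ (opKinv hq) (fun g => by
    rw [opKinv_gen, map_smul, matRep_tPol, scaleMat_mul_leftMul (inv_ne_zero (qh_ne_zero hq)),
      smul_mul_assoc]) f

theorem matAction_H_mul_leftMul (g : TGen) :
    matAction q .H * leftMul q g = (wt g : ℂ) • leftMul q g + leftMul q g * matAction q .H := by
  ext F ⟨r, c, b⟩
  cases g <;> rcases r with _ | r <;>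
    simp only [matAction, leftMul, Module.End.mul_apply, LinearMap.add_apply, LinearMap.smul_apply,
      Pi.add_apply, Pi.smul_apply, smul_eq_mul, weightedComp_apply, id_eq, wt, shiftCoeff_zero,
      Nat.add_sub_cancel] <;>
    push_cast <;> ring

theorem matAction_H_mul_matRep (f : Pol q) :
    matAction q .H * matRep hq f = matRep hq (opH q f) + matRep hq f * matAction q .H := by
  simpa using twisted_leibniz_of_generators (matRep hq) (.id ℂ _) (.id ℂ _) (opH q) (opH_mul q)
    (B := 1) (D := matAction q .H) (fun f => by simp)
    (fun g => by simp [opH_gen, matRep_tPol, matAction_H_mul_leftMul]) f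

theorem matAction_Xp_mul_matRep (f : Pol q) :
    matAction q .Xp * matRep hq f =
      matRep hq (opXp hq f) * scaleMat (qh q)⁻¹ + matRep hq (opK hq f) * matAction q .Xp := by
  have h0 := qh_ne_zero hq
  refine twisted_leibniz_of_generators _ (opK hq) (opKinv hq) _ (opXp_mul hq)
    (scaleMat_inv_mul_matRep hq) (fun g => ?_) f
  rw [opXp_gen, opK_gen, map_smul, smul_mul_assoc, matRep_tPol]
  refine twisted_commutator_mul (zpow_ne_zero _ h0) (scaleMat_mul_leftMul h0 g)
    (by rw [scaleMat_mul_leftMul (inv_ne_zero h0), inv_zpow]) (commute_rightMulXp_leftMul g) ?_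
  have hX : opKinv hq (XpGen q g) = (qh q)⁻¹ • XpGen q g := by
    cases g <;> simp [XpGen, opKinv_gen, wt]
  rw [sq, ← mul_zpow, ← qh_mul_self hq,
    t11_mul_inv_commutator hq (isQuantumSL2_leftMul hq) (leftMul_t12_mul_inv hq)
      (leftMulInv12_mul_t12 hq),
    mul_smul_comm, ← matRep, scaleMat_inv_mul_matRep, hX, map_smul, smul_mul_assoc, smul_smul,
    smul_smul]
  convert one_smul ℂ _
  refine .trans ?_ (kappa_mul_inv_sq_sub_one hq)
  rw [qh_mul_self hq]
  field_simp
  ring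

theorem matAction_Xm_mul_matRep (f : Pol q) :
    matAction q .Xm * matRep hq f =
      matRep hq (opXm hq f) * scaleMat (qh q)⁻¹ + matRep hq (opK hq f) * matAction q .Xm := by
  have h0 := qh_ne_zero hq
  refine twisted_leibniz_of_generators _ (opK hq) (opKinv hq) _ (opXm_mul hq)
    (scaleMat_inv_mul_matRep hq) (fun g => ?_) f
  rw [opXm_gen, opK_gen, map_smul, smul_mul_assoc, matRep_tPol]
  refine twisted_commutator_mul (zpow_ne_zero _ h0) (scaleMat_mul_leftMul h0 g)
    (by rw [scaleMat_mul_leftMul (inv_ne_zero h0), inv_zpow]) (commute_rightMulXm_leftMul g) ?_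
  have hX : opKinv hq (XmGen q g) = qh q • XmGen q g := by
    cases g <;> simp [XmGen, opKinv_gen, wt]
  rw [sq, ← mul_zpow, ← qh_mul_self hq,
    t22_mul_inv_commutator hq (isQuantumSL2_leftMul hq) (leftMul_t21_mul_inv hq)
      (leftMulInv21_mul_t21 hq),
    mul_smul_comm, ← matRep, scaleMat_inv_mul_matRep, hX, map_smul, smul_mul_assoc, smul_smul,
    smul_smul]
  convert one_smul ℂ _
  refine .trans ?_ (kappa_mul_inv_sq_sub_one hq)
  rw [qh_mul_self hq]
  field_simp

end MatAction

/-! ### Polynomials as matrices -/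

/-- The product `(q^{-2} - 1)(q^{-4} - 1) ⋯ (q^{-2n} - 1)`. -/
def shiftFactorial (q : ℝ) (n : ℕ) : ℂ := ∏ j ∈ Finset.range n, shiftCoeff q (j + 1)

theorem shiftFactorial_succ (q : ℝ) (n : ℕ) :
    shiftFactorial q (n + 1) = shiftFactorial q n * shiftCoeff q (n + 1) :=
  Finset.prod_range_succ _ _

theorem shiftFactorial_ne_zero {q : ℝ} (hq : q ∈ Set.Ioo (0 : ℝ) 1) (n : ℕ) :
    shiftFactorial q n ≠ 0 :=
  Finset.prod_ne_zero_iff.mpr fun j _ => shiftCoeff_succ_ne_zero hq j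

/-- The matrix of the constant polynomial `1`. Rescaling the columns of the identity matrix by
`shiftFactorial` keeps square roots of `q^{-2r} - 1` out of the matrix elements of `t₁₁`. -/
def oneMat (q : ℝ) : PhaseMat := fun (r, c, b) => if r = c ∧ b = 0 then shiftFactorial q r else 0

theorem scaleMat_oneMat (q : ℝ) (a : ℂ) : scaleMat a (oneMat q) = oneMat q := by
  ext ⟨r, c, b⟩
  simp only [scaleMat, weightedComp_apply, oneMat, id_eq]
  split_ifs with h
  · simp [h]
  · exact mul_zero _

theorem rightMulXp_oneMat (q : ℝ) :
    rightMulXp q (oneMat q) = leftMul q .t11 (leftMulInv12 q (oneMat q)) := by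
  ext ⟨r, c, b⟩
  rcases r with _ | r
  · simp [rightMulXp, leftMul, leftMulInv12, weightedComp_apply, oneMat, shiftCoeff_zero]
  · simp only [rightMulXp, leftMul, leftMulInv12, weightedComp_apply, oneMat,
      Nat.add_right_cancel_iff, Nat.add_sub_cancel, shiftFactorial_succ]
    split_ifs with h
    · rw [h.1]; ring
    · ring

theorem rightMulXm_oneMat (q : ℝ) :
    rightMulXm q (oneMat q) = leftMul q .t22 (leftMulInv21 q (oneMat q)) := by
  ext ⟨r, c, b⟩
  rcases c with _ | c
  · simp [rightMulXm, leftMul, leftMulInv21, weightedComp_apply, oneMat, shiftCoeff_zero]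
  · simp only [rightMulXm, leftMul, leftMulInv21, weightedComp_apply, oneMat,
      Nat.add_right_cancel_iff, Nat.add_sub_cancel, shiftFactorial_succ]
    split_ifs with h
    · rw [h.1]; ring
    · ring

theorem scaleMat_rightMulXp {a : ℂ} (ha : a ≠ 0) (q : ℝ) (F : PhaseMat) :
    scaleMat a (rightMulXp q F) = a ^ 2 • rightMulXp q (scaleMat a F) := by
  ext ⟨r, c, b⟩
  simp only [scaleMat, rightMulXp, weightedComp_apply, id_eq, Pi.smul_apply, smul_eq_mul,
    zpow_sub₀ ha, zpow_add₀ ha, zpow_natCast, zpow_one]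
  field_simp
  ring

theorem scaleMat_rightMulXm {a : ℂ} (ha : a ≠ 0) (q : ℝ) (F : PhaseMat) :
    scaleMat a (rightMulXm q F) = (a ^ 2)⁻¹ • rightMulXm q (scaleMat a F) := by
  ext ⟨r, c, b⟩
  simp only [scaleMat, rightMulXm, weightedComp_apply, id_eq, Pi.smul_apply, smul_eq_mul]
  rcases c with _ | c
  · rw [shiftCoeff_zero]
    ring
  · simp only [Nat.add_sub_cancel, Nat.cast_add, zpow_sub₀ ha, zpow_add₀ ha, zpow_natCast, zpow_one,
      Nat.cast_one]
    field_simp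

theorem matAction_oneMat {q : ℝ} (hq : q ∈ Set.Ioo (0 : ℝ) 1) (u : UGen) :
    matAction q u (oneMat q) = counitGen u • oneMat q := by
  have h0 := qh_ne_zero hq
  cases u <;> simp only [matAction, counitGen, zero_smul, one_smul, scaleMat_oneMat]
  · ext ⟨r, c, b⟩
    simp only [weightedComp_apply, oneMat, id_eq, Pi.zero_apply]
    split_ifs with h
    · simp [h]
    · exact mul_zero _
  · simp only [LinearMap.add_apply, LinearMap.smul_apply, Module.End.mul_apply,
      ← rightMulXp_oneMat, scaleMat_rightMulXp h0, scaleMat_rightMulXp (inv_ne_zero h0),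
      scaleMat_oneMat]
    match_scalars
    field_simp
    ring
  · simp only [LinearMap.add_apply, LinearMap.smul_apply, Module.End.mul_apply,
      ← rightMulXm_oneMat, scaleMat_rightMulXm h0, scaleMat_rightMulXm (inv_ne_zero h0),
      scaleMat_oneMat]
    match_scalars
    field_simp
    ring

/-- The matrix of a polynomial. -/
def polMat {q : ℝ} (hq : q ∈ Set.Ioo (0 : ℝ) 1) : Pol q →ₗ[ℂ] PhaseMat :=
  LinearMap.applyₗ (oneMat q) ∘ₗ (matRep hq).toLinearMap

theorem polMat_apply {q : ℝ} (hq : q ∈ Set.Ioo (0 : ℝ) 1) (f : Pol q) :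
    polMat hq f = matRep hq f (oneMat q) := rfl

theorem matAction_polMat {q : ℝ} (hq : q ∈ Set.Ioo (0 : ℝ) 1) (u : UGen) (f : Pol q) :
    matAction q u (polMat hq f) = polMat hq (polActionGen hq u f) := by
  have h1 := matAction_oneMat hq u
  simp only [polMat_apply, polActionGen, ← Module.End.mul_apply]
  cases u <;> simp only [counitGen, zero_smul, one_smul] at h1
  · rw [matAction_H_mul_matRep, LinearMap.add_apply, Module.End.mul_apply, h1, map_zero, add_zero]
  · rw [matAction_Xp_mul_matRep, LinearMap.add_apply, Module.End.mul_apply, Module.End.mul_apply,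
      h1, map_zero, add_zero, scaleMat_oneMat]
  · rw [matAction_Xm_mul_matRep, LinearMap.add_apply, Module.End.mul_apply, Module.End.mul_apply,
      h1, map_zero, add_zero, scaleMat_oneMat]
  · rw [matAction, scaleMat_mul_matRep, Module.End.mul_apply, scaleMat_oneMat]; rfl
  · rw [matAction, scaleMat_inv_mul_matRep, Module.End.mul_apply, scaleMat_oneMat]; rfl

theorem weightedComp_pow {X : Type*} {w : X → ℂ} {σ : X → X} (hw : ∀ x, w (σ x) = w x) (n : ℕ) :
    weightedComp w σ ^ n = weightedComp (w ^ n) σ^[n] := by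
  induction n with
  | zero => ext; simp [weightedComp_apply]
  | succ n ih =>
    ext F x
    simp only [pow_succ', ih, Module.End.mul_apply, weightedComp_apply, Pi.mul_apply, Pi.pow_apply,
      hw, Function.iterate_succ_apply, mul_assoc]

section Monomials

variable {q : ℝ} (hq : q ∈ Set.Ioo (0 : ℝ) 1)

theorem leftMul_t11_apply (F : PhaseMat) (r c : ℕ) (b : ℤ) :
    leftMul q .t11 F (r, c, b) = shiftCoeff q r * F (r - 1, c, b) := rfl

theorem leftMul_t11_pow_add (n : ℕ) (F : PhaseMat) (m c : ℕ) (b : ℤ) :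
    shiftFactorial q m * (leftMul q .t11 ^ n) F (m + n, c, b) =
      shiftFactorial q (m + n) * F (m, c, b) := by
  induction n with
  | zero => rfl
  | succ n ih =>
    rw [pow_succ', Module.End.mul_apply, leftMul_t11_apply, ← add_assoc, Nat.add_sub_cancel,
      mul_left_comm, ih, shiftFactorial_succ]
    ring

theorem leftMul_t11_pow_of_lt {n r : ℕ} (h : r < n) (F : PhaseMat) (c : ℕ) (b : ℤ) :
    (leftMul q .t11 ^ n) F (r, c, b) = 0 := by
  induction n generalizing r with
  | zero => omega
  | succ n ih =>
    rw [pow_succ', Module.End.mul_apply, leftMul_t11_apply]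
    rcases r with _ | r
    · rw [shiftCoeff_zero, zero_mul]
    · rw [Nat.add_sub_cancel, ih (by omega), mul_zero]

theorem leftMul_t12_pow (n : ℕ) (F : PhaseMat) (r c : ℕ) (b : ℤ) :
    (leftMul q .t12 ^ n) F (r, c, b) = ((q : ℂ) ^ r)⁻¹ ^ n * F (r, c, b - n) := by
  have h : (fun (r, c, b) => (r, c, b - 1) : ℕ × ℕ × ℤ → ℕ × ℕ × ℤ)^[n] (r, c, b) =
      (r, c, b - n) := by
    induction n generalizing b with
    | zero => simp
    | succ n ih => rw [Function.iterate_succ_apply, ih]; grind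
  rw [leftMul, weightedComp_pow, weightedComp_apply, h, Pi.pow_apply]
  exact fun _ => rfl

theorem matRep_t12star :
    matRep hq (t12star q) =
      weightedComp (fun (r, _, _) => ((q : ℂ) ^ r)⁻¹) fun (r, c, b) => (r, c, b + 1) := by
  have hq0 := ofReal_ne_zero_of_mem_Ioo hq
  ext F ⟨r, c, b⟩
  simp only [t12star, map_neg, map_smul, matRep_tPol, leftMul, LinearMap.neg_apply,
    LinearMap.smul_apply, Pi.neg_apply, Pi.smul_apply, smul_eq_mul, weightedComp_apply]
  field_simp
  ring

theorem matRep_t12star_pow (n : ℕ) (F : PhaseMat) (r c : ℕ) (b : ℤ) :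
    (matRep hq (t12star q) ^ n) F (r, c, b) = ((q : ℂ) ^ r)⁻¹ ^ n * F (r, c, b + n) := by
  have h : (fun (r, c, b) => (r, c, b + 1) : ℕ × ℕ × ℤ → ℕ × ℕ × ℤ)^[n] (r, c, b) =
      (r, c, b + n) := by
    induction n generalizing b with
    | zero => simp
    | succ n ih => rw [Function.iterate_succ_apply, ih]; grind
  rw [matRep_t12star, weightedComp_pow, weightedComp_apply, h, Pi.pow_apply]
  exact fun _ => rfl

theorem matRep_t11star_pow (n : ℕ) (F : PhaseMat) (r c : ℕ) (b : ℤ) :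
    (matRep hq (t11star q) ^ n) F (r, c, b) = F (r + n, c, b) := by
  induction n generalizing F with
  | zero => rfl
  | succ n ih =>
    rw [pow_succ, Module.End.mul_apply, ih, t11star, map_neg, matRep_tPol]
    simp [leftMul, weightedComp_apply, add_assoc]

theorem matRep_xPol :
    matRep hq (xPol q) = Algebra.lmul ℂ PhaseMat fun (r, _, _) => ((q : ℂ) ^ (2 * r))⁻¹ := by
  ext F ⟨r, c, b⟩
  rw [xPol, map_mul, Module.End.mul_apply, matRep_tPol, matRep_t12star]
  simp [leftMul, weightedComp_apply, two_mul, pow_add, mul_assoc]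

theorem matRep_aeval_xPol (p : Polynomial ℂ) (F : PhaseMat) (r c : ℕ) (b : ℤ) :
    matRep hq (Polynomial.aeval (xPol q) p) F (r, c, b) =
      p.eval (((q : ℂ) ^ (2 * r))⁻¹) * F (r, c, b) := by
  rw [← Polynomial.aeval_algHom_apply, matRep_xPol, Polynomial.aeval_algHom_apply]
  simp

end Monomials

@[ext]
theorem Idx.ext {i i' : Idx} (h₁ : i.i₁ = i'.i₁) (h₂ : i.i₂ = i'.i₂) (h₃ : i.j₁ = i'.j₁)
    (h₄ : i.j₂ = i'.j₂) : i = i' := by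
  cases i; cases i'; simp_all only

theorem Idx.eq_of_sub_eq {i i' : Idx} (h₁ : (i.i₁ : ℤ) - i.j₁ = i'.i₁ - i'.j₁)
    (h₂ : (i.i₂ : ℤ) - i.j₂ = i'.i₂ - i'.j₂) : i = i' := by
  have a := Nat.mul_eq_zero.mp i.h₁
  have b := Nat.mul_eq_zero.mp i.h₂
  have a' := Nat.mul_eq_zero.mp i'.h₁
  have b' := Nat.mul_eq_zero.mp i'.h₂
  ext <;> omega

/-- The position of the only matrix entry to which the coefficient `ψ_i(q^{-2m})` contributes. -/
def entryEquiv : Idx × ℕ ≃ ℕ × ℕ × ℤ where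
  toFun p := (p.2 + p.1.i₁, p.2 + p.1.j₁, p.1.i₂ - p.1.j₂)
  invFun p := (⟨p.1 - p.2.1, p.2.2.toNat, p.2.1 - p.1, (-p.2.2).toNat,
    by rw [Nat.mul_eq_zero]; omega, by rw [Nat.mul_eq_zero]; omega⟩, min p.1 p.2.1)
  left_inv p := by
    have h := Nat.mul_eq_zero.mp p.1.h₁
    refine Prod.ext (Idx.eq_of_sub_eq ?_ ?_) ?_ <;> dsimp only <;> omega
  right_inv p := by
    refine Prod.ext ?_ (Prod.ext ?_ ?_) <;> dsimp only <;> omega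

theorem entryEquiv_apply (i : Idx) (m : ℕ) :
    entryEquiv (i, m) = (m + i.i₁, m + i.j₁, (i.i₂ - i.j₂ : ℤ)) := rfl

/-- The ratio of the matrix entry at `entryEquiv (i, m)` to the coefficient `ψ_i(q^{-2m})`. -/
def coeffScale (q : ℝ) (i : Idx) (m : ℕ) : ℂ :=
  shiftFactorial q (m + i.i₁ + i.j₁) * ((q : ℂ) ^ m)⁻¹ ^ (i.i₂ + i.j₂)

theorem coeffScale_ne_zero {q : ℝ} (hq : q ∈ Set.Ioo (0 : ℝ) 1) (i : Idx) (m : ℕ) :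
    coeffScale q i m ≠ 0 :=
  mul_ne_zero (shiftFactorial_ne_zero hq _) <|
    pow_ne_zero _ <| inv_ne_zero <| pow_ne_zero _ <| ofReal_ne_zero_of_mem_Ioo hq

theorem shiftFactorial_mul_coeffScale (q : ℝ) (i : Idx) (m : ℕ) :
    shiftFactorial q m * coeffScale q i m =
      shiftFactorial q (m + i.i₁) * shiftFactorial q (m + i.j₁) *
        ((q : ℂ) ^ m)⁻¹ ^ (i.i₂ + i.j₂) := by
  rw [coeffScale]
  rcases Nat.mul_eq_zero.mp i.h₁ with h | h <;> simp only [h, add_zero] <;> ring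

section CoefficientEquiv

variable {q : ℝ} (hq : q ∈ Set.Ioo (0 : ℝ) 1)

/-- The identification of distributions with matrices that extends `polMat`. -/
def matEquiv : Distr ≃L[ℂ] PhaseMat where
  toFun f p := coeffScale q (entryEquiv.symm p).1 (entryEquiv.symm p).2 *
    f (entryEquiv.symm p).1 (entryEquiv.symm p).2
  invFun F i m := (coeffScale q i m)⁻¹ * F (entryEquiv (i, m))
  map_add' f g := funext fun p => mul_add _ _ _
  map_smul' a f := funext fun p => mul_left_comm _ _ _
  left_inv f := by
    ext i m
    dsimp only
    rw [Equiv.symm_apply_apply, inv_mul_cancel_left₀ (coeffScale_ne_zero hq i m)]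
  right_inv F := by
    ext p
    dsimp only
    rw [Prod.mk.eta, Equiv.apply_symm_apply, mul_inv_cancel_left₀ (coeffScale_ne_zero hq _ _)]
  continuous_toFun := by fun_prop
  continuous_invFun := by fun_prop

theorem matEquiv_apply (f : Distr) (p : ℕ × ℕ × ℤ) :
    matEquiv hq f p = coeffScale q (entryEquiv.symm p).1 (entryEquiv.symm p).2 *
      f (entryEquiv.symm p).1 (entryEquiv.symm p).2 := rfl

theorem matEquiv_apply_entryEquiv (f : Distr) (i : Idx) (m : ℕ) :
    matEquiv hq f (entryEquiv (i, m)) = coeffScale q i m * f i m := by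
  rw [matEquiv_apply, Equiv.symm_apply_apply]

theorem polMat_monomial (i : Idx) (p : Polynomial ℂ) (i' : Idx) (m : ℕ) :
    polMat hq (tPol q .t11 ^ i.i₁ * tPol q .t12 ^ i.i₂ * Polynomial.aeval (xPol q) p *
      t12star q ^ i.j₂ * t11star q ^ i.j₁) (entryEquiv (i', m)) =
    coeffScale q i' m * (Finsupp.single i p i').eval (((q : ℂ) ^ (2 * m))⁻¹) := by
  simp only [polMat_apply, entryEquiv_apply, map_mul, map_pow, Module.End.mul_apply, matRep_tPol]
  rcases eq_or_ne i i' with rfl | hne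
  · apply mul_left_cancel₀ (shiftFactorial_ne_zero hq m)
    have hb : (i.i₂ : ℤ) - i.j₂ - i.i₂ + i.j₂ = 0 := by ring
    rw [leftMul_t11_pow_add, leftMul_t12_pow, matRep_aeval_xPol, matRep_t12star_pow,
      matRep_t11star_pow, hb, oneMat, if_pos ⟨rfl, rfl⟩, Finsupp.single_eq_same,
      ← mul_assoc (shiftFactorial q m), shiftFactorial_mul_coeffScale, pow_add]
    ring
  · rw [Finsupp.single_eq_of_ne' hne, Polynomial.eval_zero, mul_zero]
    obtain hlt | ⟨r, hr⟩ := lt_or_ge (m + i'.i₁) i.i₁ |>.imp_right Nat.exists_eq_add_of_le'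
    · exact leftMul_t11_pow_of_lt hlt _ _ _
    · refine (mul_eq_zero_iff_left (shiftFactorial_ne_zero hq r)).mp ?_
      rw [hr, leftMul_t11_pow_add, leftMul_t12_pow, matRep_aeval_xPol, matRep_t12star_pow,
        matRep_t11star_pow, oneMat, if_neg]
      · simp only [mul_zero]
      · rintro ⟨h1, h2⟩
        exact hne (Idx.eq_of_sub_eq (by omega) (by omega))

theorem polMat_expand (ψ : Idx →₀ Polynomial ℂ) :
    polMat hq (expand q ψ) = matEquiv hq (toDistr q ψ) := by
  ext p
  obtain ⟨⟨i, m⟩, rfl⟩ := entryEquiv.surjective p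
  rw [matEquiv_apply_entryEquiv, expand, Finsupp.sum, map_sum, Finset.sum_apply]
  simp only [polMat_monomial]
  rw [← Finset.mul_sum, ← Polynomial.eval_finsetSum, toDistr, ← Finsupp.finsetSum_apply,
    ← Finsupp.sum, Finsupp.sum_single]

/-- The distribution defined by a polynomial. -/
def polDistr : Pol q →ₗ[ℂ] Distr :=
  (matEquiv hq).symm.toLinearEquiv.toLinearMap ∘ₗ polMat hq

theorem matEquiv_polDistr (f : Pol q) : matEquiv hq (polDistr hq f) = polMat hq f :=
  (matEquiv hq).apply_symm_apply _

theorem polDistr_expand (ψ : Idx →₀ Polynomial ℂ) : polDistr hq (expand q ψ) = toDistr q ψ :=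
  (matEquiv hq).injective <| by rw [matEquiv_polDistr, polMat_expand]

end CoefficientEquiv

/-! ### Spanning by ordered monomials -/

theorem mul_pow_of_mul_eq_smul {A : Type*} [Ring A] [Algebra ℂ A] {x y : A} {c : ℂ}
    (h : x * y = c • (y * x)) (n : ℕ) : x * y ^ n = c ^ n • (y ^ n * x) := by
  induction n with
  | zero => simp only [pow_zero, mul_one, one_mul, one_smul]
  | succ n ih =>
    rw [pow_succ, ← mul_assoc, ih, smul_mul_assoc, mul_assoc, h, mul_smul_comm, smul_smul,
      mul_assoc, pow_succ]

theorem mul_pow_mul_pow_of_mul_eq_smul {A : Type*} [Ring A] [Algebra ℂ A] {x y z : A} {c : ℂ}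
    (hy : x * y = c • (y * x)) (hz : x * z = c • (z * x)) (i j : ℕ) :
    x * (y ^ i * z ^ j) = c ^ (i + j) • (y ^ i * z ^ j * x) := by
  rw [← mul_assoc, mul_pow_of_mul_eq_smul hy, smul_mul_assoc, mul_assoc,
    mul_pow_of_mul_eq_smul hz, mul_smul_comm, smul_smul, pow_add, mul_assoc]

section Spanning

variable {q : ℝ}

theorem t11star_eq_smul (q : ℝ) : t11star q = (-1 : ℂ) • tPol q .t22 :=
  (neg_one_smul ℂ (tPol q .t22)).symm

theorem t12star_eq_smul (q : ℝ) : t12star q = (-(q : ℂ)) • tPol q .t21 :=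
  (neg_smul (q : ℂ) (tPol q .t21)).symm

theorem t11_mul_t12star :
    tPol q .t11 * t12star q = (q : ℂ) • (t12star q * tPol q .t11) := by
  rw [t12star_eq_smul, mul_smul_comm, (isQuantumSL2_tPol q).r3, smul_mul_assoc, smul_comm]

theorem commute_t12star_t12 : Commute (t12star q) (tPol q .t12) := by
  rw [Commute, SemiconjBy, t12star_eq_smul, mul_smul_comm, (isQuantumSL2_tPol q).r5,
    smul_mul_assoc]

theorem t11star_mul_t12 (hq0 : (q : ℂ) ≠ 0) :
    t11star q * tPol q .t12 = (q : ℂ)⁻¹ • (tPol q .t12 * t11star q) := by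
  rw [t11star_eq_smul, mul_smul_comm, (isQuantumSL2_tPol q).r4, smul_mul_assoc,
    smul_comm (-1 : ℂ), inv_smul_smul₀ hq0]

theorem t11star_mul_t12star (hq0 : (q : ℂ) ≠ 0) :
    t11star q * t12star q = (q : ℂ)⁻¹ • (t12star q * t11star q) := by
  rw [eq_inv_smul_iff₀ hq0]
  simp only [t11star_eq_smul, t12star_eq_smul, mul_smul_comm, smul_mul_assoc,
    (isQuantumSL2_tPol q).r2]
  match_scalars
  ring

theorem t11_mul_t11star : tPol q .t11 * t11star q = tPol q .t12 * t12star q - 1 := by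
  have h := sub_eq_iff_eq_add.mp (isQuantumSL2_tPol q).r7
  simp only [t11star_eq_smul, t12star_eq_smul, mul_smul_comm, h]
  module

theorem t11star_mul_t11 (hq0 : (q : ℂ) ≠ 0) :
    t11star q * tPol q .t11 = ((q : ℂ) ^ 2)⁻¹ • (tPol q .t12 * t12star q) - 1 := by
  have h := sub_eq_iff_eq_add.mp (isQuantumSL2_tPol q).r7
  have h' := eq_sub_of_add_eq' (sub_eq_iff_eq_add.mp (isQuantumSL2_tPol q).r6).symm
  simp only [t11star_eq_smul, t12star_eq_smul, mul_smul_comm, smul_mul_assoc, h', h]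
  match_scalars
  · ring
  · field_simp
    ring

/-- The monomial `t₁₂ⁱ t₁₂*ʲ`. -/
def t12Monomial (q : ℝ) (i j : ℕ) : Pol q := tPol q .t12 ^ i * t12star q ^ j

theorem t12_mul_t12Monomial (i j : ℕ) :
    tPol q .t12 * t12Monomial q i j = t12Monomial q (i + 1) j := by
  rw [t12Monomial, ← mul_assoc, ← pow_succ', t12Monomial]

theorem t12star_mul_t12Monomial (i j : ℕ) :
    t12star q * t12Monomial q i j = t12Monomial q i (j + 1) := by
  rw [t12Monomial, ← mul_assoc, (commute_t12star_t12.pow_right i).eq, mul_assoc, ← pow_succ',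
    t12Monomial]

theorem t12Monomial_mul_t12_mul_t12star (i j : ℕ) :
    t12Monomial q i j * (tPol q .t12 * t12star q) = t12Monomial q (i + 1) (j + 1) := by
  rw [t12Monomial, ← mul_assoc, mul_assoc (_ ^ i), (commute_t12star_t12.pow_left j).eq,
    ← mul_assoc, ← pow_succ, mul_assoc, ← pow_succ, t12Monomial]

theorem t12Monomial_eq (i j : ℕ) :
    t12Monomial q i j = tPol q .t12 ^ (i - j) * xPol q ^ min i j * t12star q ^ (j - i) := by
  rw [xPol, commute_t12star_t12.symm.mul_pow, ← mul_assoc, ← pow_add, mul_assoc, ← pow_add,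
    Nat.sub_add_min_cancel, Nat.min_comm, Nat.add_comm, Nat.sub_add_min_cancel, t12Monomial]

theorem t11_mul_t12Monomial (i j : ℕ) :
    tPol q .t11 * t12Monomial q i j = (q : ℂ) ^ (i + j) • (t12Monomial q i j * tPol q .t11) :=
  mul_pow_mul_pow_of_mul_eq_smul (isQuantumSL2_tPol q).r1 t11_mul_t12star i j

theorem t11star_mul_t12Monomial (hq0 : (q : ℂ) ≠ 0) (i j : ℕ) :
    t11star q * t12Monomial q i j = (q : ℂ)⁻¹ ^ (i + j) • (t12Monomial q i j * t11star q) :=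
  mul_pow_mul_pow_of_mul_eq_smul (t11star_mul_t12 hq0) (t11star_mul_t12star hq0) i j

/-- The span of the ordered monomials in `t₁₁`, `t₁₂`, `t₁₂*`, `t₁₁*` that do not contain both
`t₁₁` and `t₁₁*`. -/
def monomialSpan (q : ℝ) : Submodule ℂ (Pol q) :=
  Submodule.span ℂ
    (Set.range (fun n : ℕ × ℕ × ℕ => tPol q .t11 ^ n.1 * t12Monomial q n.2.1 n.2.2) ∪
      Set.range fun n : ℕ × ℕ × ℕ => t12Monomial q n.2.1 n.2.2 * t11star q ^ n.1)

theorem t11_pow_mul_mem_monomialSpan (a i j : ℕ) :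
    tPol q .t11 ^ a * t12Monomial q i j ∈ monomialSpan q :=
  Submodule.subset_span (Or.inl ⟨(a, i, j), rfl⟩)

theorem mul_t11star_pow_mem_monomialSpan (a i j : ℕ) :
    t12Monomial q i j * t11star q ^ a ∈ monomialSpan q :=
  Submodule.subset_span (Or.inr ⟨(a, i, j), rfl⟩)

theorem mul_mem_monomialSpan {y : Pol q}
    (hl : ∀ a i j, y * (tPol q .t11 ^ a * t12Monomial q i j) ∈ monomialSpan q)
    (hr : ∀ a i j, y * (t12Monomial q i j * t11star q ^ a) ∈ monomialSpan q)
    {f : Pol q} (hf : f ∈ monomialSpan q) : y * f ∈ monomialSpan q := by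
  have h : monomialSpan q ≤ (monomialSpan q).comap (LinearMap.mulLeft ℂ y) := by
    rw [monomialSpan, Submodule.span_le]
    rintro _ (⟨⟨a, i, j⟩, rfl⟩ | ⟨⟨a, i, j⟩, rfl⟩)
    · exact hl a i j
    · exact hr a i j
  exact h hf

theorem t11_mul_mem_monomialSpan {f : Pol q} (hf : f ∈ monomialSpan q) :
    tPol q .t11 * f ∈ monomialSpan q := by
  refine mul_mem_monomialSpan (fun a i j => ?_) (fun a i j => ?_) hf
  · rw [← mul_assoc, ← pow_succ']
    exact t11_pow_mul_mem_monomialSpan _ _ _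
  · rcases a with _ | a
    · simpa using t11_pow_mul_mem_monomialSpan (q := q) 1 i j
    · have h : tPol q .t11 * (t12Monomial q i j * t11star q ^ (a + 1)) =
          (q : ℂ) ^ (i + j) • (t12Monomial q (i + 1) (j + 1) * t11star q ^ a -
            t12Monomial q i j * t11star q ^ a) := by
        rw [← mul_assoc, t11_mul_t12Monomial, smul_mul_assoc, pow_succ', mul_assoc,
          ← mul_assoc (tPol q .t11), t11_mul_t11star, ← mul_assoc, mul_sub,
          t12Monomial_mul_t12_mul_t12star, mul_one, sub_mul]
      rw [h]
      exact Submodule.smul_mem _ _ <| Submodule.sub_mem _ (mul_t11star_pow_mem_monomialSpan _ _ _)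
        (mul_t11star_pow_mem_monomialSpan _ _ _)

theorem t12_mul_mem_monomialSpan (hq0 : (q : ℂ) ≠ 0) {f : Pol q} (hf : f ∈ monomialSpan q) :
    tPol q .t12 * f ∈ monomialSpan q := by
  have h : tPol q .t12 * tPol q .t11 = (q : ℂ)⁻¹ • (tPol q .t11 * tPol q .t12) := by
    rw [(isQuantumSL2_tPol q).r1, inv_smul_smul₀ hq0]
  refine mul_mem_monomialSpan (fun a i j => ?_) (fun a i j => ?_) hf
  · rw [← mul_assoc, mul_pow_of_mul_eq_smul h, smul_mul_assoc, mul_assoc, t12_mul_t12Monomial]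
    exact Submodule.smul_mem _ _ (t11_pow_mul_mem_monomialSpan _ _ _)
  · rw [← mul_assoc, t12_mul_t12Monomial]
    exact mul_t11star_pow_mem_monomialSpan _ _ _

theorem t12star_mul_mem_monomialSpan (hq0 : (q : ℂ) ≠ 0) {f : Pol q} (hf : f ∈ monomialSpan q) :
    t12star q * f ∈ monomialSpan q := by
  have h : t12star q * tPol q .t11 = (q : ℂ)⁻¹ • (tPol q .t11 * t12star q) := by
    rw [t11_mul_t12star, inv_smul_smul₀ hq0]
  refine mul_mem_monomialSpan (fun a i j => ?_) (fun a i j => ?_) hf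
  · rw [← mul_assoc, mul_pow_of_mul_eq_smul h, smul_mul_assoc, mul_assoc, t12star_mul_t12Monomial]
    exact Submodule.smul_mem _ _ (t11_pow_mul_mem_monomialSpan _ _ _)
  · rw [← mul_assoc, t12star_mul_t12Monomial]
    exact mul_t11star_pow_mem_monomialSpan _ _ _

theorem t11star_mul_mem_monomialSpan (hq0 : (q : ℂ) ≠ 0) {f : Pol q} (hf : f ∈ monomialSpan q) :
    t11star q * f ∈ monomialSpan q := by
  have hr (a i j : ℕ) : t11star q * (t12Monomial q i j * t11star q ^ a) ∈ monomialSpan q := by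
    rw [← mul_assoc, t11star_mul_t12Monomial hq0, smul_mul_assoc, mul_assoc, ← pow_succ']
    exact Submodule.smul_mem _ _ (mul_t11star_pow_mem_monomialSpan _ _ _)
  refine mul_mem_monomialSpan (fun a i j => ?_) hr hf
  rcases a with _ | a
  · simpa using hr 0 i j
  · rw [pow_succ', mul_assoc, ← mul_assoc, t11star_mul_t11 hq0, sub_mul, one_mul, smul_mul_assoc,
      mul_assoc]
    have h := t11_pow_mul_mem_monomialSpan (q := q) a i j
    exact Submodule.sub_mem _ (Submodule.smul_mem _ _ <|
      t12_mul_mem_monomialSpan hq0 <| t12star_mul_mem_monomialSpan hq0 h) h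

theorem mul_mem_monomialSpan_of_mem (hq0 : (q : ℂ) ≠ 0) (f : Pol q) {g : Pol q}
    (hg : g ∈ monomialSpan q) : f * g ∈ monomialSpan q := by
  induction f using pol_induction generalizing g with
  | halg c =>
    rw [← Algebra.smul_def]
    exact Submodule.smul_mem _ _ hg
  | hgen t =>
    cases t with
    | t11 => exact t11_mul_mem_monomialSpan hg
    | t12 => exact t12_mul_mem_monomialSpan hq0 hg
    | t21 =>
      rw [← inv_smul_smul₀ (neg_ne_zero.mpr hq0) (tPol q .t21), ← t12star_eq_smul, smul_mul_assoc]
      exact Submodule.smul_mem _ _ (t12star_mul_mem_monomialSpan hq0 hg)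
    | t22 =>
      rw [← neg_neg (tPol q .t22), neg_mul]
      exact Submodule.neg_mem _ (t11star_mul_mem_monomialSpan hq0 hg)
  | hmul x y hx hy => exact mul_assoc x y g ▸ hx (hy hg)
  | hadd x y hx hy => exact add_mul x y g ▸ Submodule.add_mem _ (hx hg) (hy hg)

theorem mem_monomialSpan (hq0 : (q : ℂ) ≠ 0) (f : Pol q) : f ∈ monomialSpan q := by
  have h1 : (1 : Pol q) ∈ monomialSpan q := by
    simpa [t12Monomial] using t11_pow_mul_mem_monomialSpan (q := q) 0 0 0
  simpa using mul_mem_monomialSpan_of_mem hq0 f h1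

theorem expand_add (ψ φ : Idx →₀ Polynomial ℂ) : expand q (ψ + φ) = expand q ψ + expand q φ :=
  Finsupp.sum_add_index' (by simp) (by simp [mul_add, add_mul])

theorem expand_smul (c : ℂ) (ψ : Idx →₀ Polynomial ℂ) : expand q (c • ψ) = c • expand q ψ := by
  rw [expand, Finsupp.sum_smul_index' (by simp), expand, Finsupp.smul_sum]
  simp

theorem expand_single (i : Idx) (p : Polynomial ℂ) :
    expand q (Finsupp.single i p) = tPol q .t11 ^ i.i₁ * tPol q .t12 ^ i.i₂ *
      Polynomial.aeval (xPol q) p * t12star q ^ i.j₂ * t11star q ^ i.j₁ :=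
  Finsupp.sum_single_index (by simp)

theorem expand_surjective (hq0 : (q : ℂ) ≠ 0) : Function.Surjective (expand q) := by
  intro f
  induction mem_monomialSpan hq0 f using Submodule.span_induction with
  | zero => exact ⟨0, Finsupp.sum_zero_index⟩
  | add x y _ _ hx hy =>
    obtain ⟨ψ, rfl⟩ := hx
    obtain ⟨φ, rfl⟩ := hy
    exact ⟨ψ + φ, expand_add ψ φ⟩
  | smul c x _ hx =>
    obtain ⟨ψ, rfl⟩ := hx
    exact ⟨c • ψ, expand_smul c ψ⟩
  | mem x hx =>
    have h (i j : ℕ) : (i - j) * (j - i) = 0 := by rw [Nat.mul_eq_zero]; omega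
    rcases hx with ⟨⟨a, i, j⟩, rfl⟩ | ⟨⟨a, i, j⟩, rfl⟩
    · exact ⟨Finsupp.single ⟨a, i - j, 0, j - i, mul_zero a, h i j⟩ (Polynomial.X ^ min i j), by
        simp [expand_single, t12Monomial_eq i j, mul_assoc]⟩
    · exact ⟨Finsupp.single ⟨0, i - j, a, j - i, zero_mul a, h i j⟩ (Polynomial.X ^ min i j), by
        simp [expand_single, t12Monomial_eq i j]⟩

end Spanning

/-! ### Extension to distributions -/

theorem exists_eval_eq {q : ℝ} (hq : q ∈ Set.Ioo (0 : ℝ) 1) (u : ℕ → ℂ) (N : ℕ) :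
    ∃ p : Polynomial ℂ, ∀ m < N, p.eval (((q : ℂ) ^ (2 * m))⁻¹) = u m := by
  have hinj : Function.Injective fun m : ℕ => ((q : ℂ) ^ (2 * m))⁻¹ := by
    intro m n h
    have h1 : q ^ (2 * m) = q ^ (2 * n) := by exact_mod_cast inv_injective h
    exact Nat.eq_of_mul_eq_mul_left two_pos (pow_right_injective₀ hq.1 hq.2.ne h1)
  exact ⟨Lagrange.interpolate (Finset.range N) _ u, fun m hm =>
    Lagrange.eval_interpolate_at_node u hinj.injOn (Finset.mem_range.mpr hm)⟩

theorem denseRange_toDistr {q : ℝ} (hq : q ∈ Set.Ioo (0 : ℝ) 1) : DenseRange (toDistr q) := by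
  classical
  intro f
  choose p hp using fun (i : Idx) (N : ℕ) => exists_eval_eq hq (f i) N
  let ψ (n : Finset Idx × ℕ) : Idx →₀ Polynomial ℂ := Finsupp.indicator n.1 fun i _ => p i n.2
  refine mem_closure_of_tendsto (f := fun n => toDistr q (ψ n)) (b := Filter.atTop) ?_
    (Filter.Eventually.of_forall fun n => ⟨_, rfl⟩)
  refine tendsto_pi_nhds.mpr fun i => tendsto_pi_nhds.mpr fun m => ?_
  refine tendsto_const_nhds.congr' ?_
  filter_upwards [Filter.eventually_ge_atTop (({i} : Finset Idx), m + 1)] with n hn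
  have hi : i ∈ n.1 := Finset.singleton_subset_iff.mp hn.1
  rw [toDistr, Finsupp.indicator_of_mem hi, hp i n.2 m hn.2]

theorem continuous_weightedComp {X : Type*} (w : X → ℂ) (σ : X → X) :
    Continuous (weightedComp w σ) :=
  continuous_pi fun x => continuous_const.mul (continuous_apply (σ x))

theorem continuous_matAction (q : ℝ) (u : UGen) : Continuous (matAction q u) := by
  have h (w : ℕ × ℕ × ℤ → ℂ) (σ : ℕ × ℕ × ℤ → ℕ × ℕ × ℤ) := continuous_weightedComp w σ
  have hmul {A B : Module.End ℂ PhaseMat} (hA : Continuous A) (hB : Continuous B) :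
      Continuous (A * B) := hA.comp hB
  have hadd {A B : Module.End ℂ PhaseMat} (a b : ℂ) (hA : Continuous A) (hB : Continuous B) :
      Continuous (a • A + b • B) := (hA.const_smul a).add (hB.const_smul b)
  cases u with
  | H | k | kinv => exact h _ _
  | Xp | Xm => exact hadd _ _ (hmul (h _ _) (h _ _)) (hmul (h _ _) (hmul (h _ _) (h _ _)))

section Extension

variable {q : ℝ} (hq : q ∈ Set.Ioo (0 : ℝ) 1)

theorem denseRange_polDistr : DenseRange (polDistr hq) :=
  (denseRange_toDistr hq).mono <| by
    rintro _ ⟨ψ, rfl⟩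
    exact ⟨expand q ψ, polDistr_expand hq ψ⟩

/-- The operators on distributions that correspond to the generators of `U_q su(1,1)`. -/
def distrActionGen (u : UGen) : Distr →L[ℂ] Distr :=
  (matEquiv hq).symm.toContinuousLinearMap ∘L
    ⟨matAction q u, continuous_matAction q u⟩ ∘L (matEquiv hq).toContinuousLinearMap

theorem matEquiv_distrActionGen (u : UGen) (f : Distr) :
    matEquiv hq (distrActionGen hq u f) = matAction q u (matEquiv hq f) :=
  (matEquiv hq).apply_symm_apply _

theorem lift_distrActionGen_polDistr (x : FreeAlgebra ℂ UGen) (f : Pol q) :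
    FreeAlgebra.lift ℂ (distrActionGen hq) x (polDistr hq f) =
      polDistr hq (FreeAlgebra.lift ℂ (polActionGen hq) x f) := by
  induction x using FreeAlgebra.induction generalizing f with
  | grade0 c => simp [Algebra.algebraMap_eq_smul_one]
  | grade1 u =>
    apply (matEquiv hq).injective
    rw [FreeAlgebra.lift_ι_apply, FreeAlgebra.lift_ι_apply, matEquiv_distrActionGen,
      matEquiv_polDistr, matEquiv_polDistr, matAction_polMat]
  | mul x y hx hy => rw [map_mul, map_mul, Module.End.mul_apply, ← hx, ← hy]; rfl
  | add x y hx hy => simp only [map_add, add_apply, LinearMap.add_apply, hx, hy]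

theorem polAction_mk (x : FreeAlgebra ℂ UGen) :
    polAction hq (RingQuot.mkAlgHom ℂ (URel q) x) = FreeAlgebra.lift ℂ (polActionGen hq) x := by
  rw [polAction, RingQuot.liftAlgHom_mkAlgHom_apply]

/-- The representation of `U_q su(1,1)` in the space of distributions. -/
def distrAction : Uq q →ₐ[ℂ] (Distr →L[ℂ] Distr) :=
  RingQuot.liftAlgHom ℂ ⟨FreeAlgebra.lift ℂ (distrActionGen hq), by
    intro x y h
    refine DFunLike.coe_injective <| (denseRange_polDistr hq).equalizer
      (ContinuousLinearMap.continuous _) (ContinuousLinearMap.continuous _) (funext fun g => ?_)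
    simp only [Function.comp_apply, lift_distrActionGen_polDistr, ← polAction_mk,
      RingQuot.mkAlgHom_rel ℂ h]⟩

theorem distrAction_mk (x : FreeAlgebra ℂ UGen) :
    distrAction hq (RingQuot.mkAlgHom ℂ (URel q) x) =
      FreeAlgebra.lift ℂ (distrActionGen hq) x := by
  rw [distrAction, RingQuot.liftAlgHom_mkAlgHom_apply]

theorem distrAction_polDistr (ξ : Uq q) (f : Pol q) :
    distrAction hq ξ (polDistr hq f) = polDistr hq (polAction hq ξ f) := by
  obtain ⟨x, rfl⟩ := RingQuot.mkAlgHom_surjective ℂ (URel q) ξ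
  rw [distrAction_mk, lift_distrActionGen_polDistr, polAction_mk]

theorem extendsPolAction_distrAction : ExtendsPolAction hq (distrAction hq) := by
  intro ξ ψ φ h
  rw [← polDistr_expand hq, ← polDistr_expand hq, distrAction_polDistr, h]

theorem ExtendsPolAction.unique {ρ ρ' : Uq q →ₐ[ℂ] (Distr →L[ℂ] Distr)}
    (h : ExtendsPolAction hq ρ) (h' : ExtendsPolAction hq ρ') : ρ' = ρ := by
  refine AlgHom.ext fun ξ => DFunLike.coe_injective <| (denseRange_toDistr hq).equalizer
    (ContinuousLinearMap.continuous _) (ContinuousLinearMap.continuous _) (funext fun ψ => ?_)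
  obtain ⟨φ, hφ⟩ := expand_surjective (ofReal_ne_zero_of_mem_Ioo hq) (polAction hq ξ (expand q ψ))
  exact (h' ξ ψ φ hφ.symm).trans (h ξ ψ φ hφ.symm).symm

end Extension

/-! ### Finite functions -/

theorem mem_finFun_iff {q : ℝ} (hq : q ∈ Set.Ioo (0 : ℝ) 1) (f : Distr) :
    f ∈ FinFun ↔ (matEquiv hq f).HasFiniteSupport := by
  refine ⟨fun hf => ?_, fun hf => ?_⟩
  · have h : (Function.uncurry f).HasFiniteSupport := hf
    exact (h.comp_of_injective entryEquiv.symm.injective).mul_right _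
  · have h : Function.uncurry f =
        (fun p => (coeffScale q p.1 p.2)⁻¹) * (matEquiv hq f ∘ entryEquiv) := by
      ext ⟨i, m⟩
      rw [Pi.mul_apply, Function.comp_apply, matEquiv_apply_entryEquiv,
        inv_mul_cancel_left₀ (coeffScale_ne_zero hq i m), Function.uncurry_apply_pair]
    have hu : (Function.uncurry f).HasFiniteSupport :=
      h ▸ (hf.comp_of_injective entryEquiv.injective).mul_right _
    exact hu

theorem hasFiniteSupport_weightedComp {X : Type*} (w : X → ℂ) {σ : X → X}
    (hσ : ∀ x, (σ ⁻¹' {x}).Finite) {F : X → ℂ} (hF : F.HasFiniteSupport) :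
    (weightedComp w σ F).HasFiniteSupport :=
  (hF.preimage' fun x _ => hσ x).subset fun _ hx => right_ne_zero_of_mul hx

theorem finite_preimage_singleton {σ : ℕ × ℕ × ℤ → ℕ × ℕ × ℤ}
    (hσ : ∀ r c b, r ≤ (σ (r, c, b)).1 + 1 ∧ c ≤ (σ (r, c, b)).2.1 + 1 ∧
      (σ (r, c, b)).2.2 - 1 ≤ b ∧ b ≤ (σ (r, c, b)).2.2 + 1) (p : ℕ × ℕ × ℤ) :
    (σ ⁻¹' {p}).Finite := by
  refine (Set.finite_Icc (0, 0, p.2.2 - 1) (p.1 + 1, p.2.1 + 1, p.2.2 + 1)).subset ?_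
  rintro ⟨r, c, b⟩ rfl
  obtain ⟨h1, h2, h3, h4⟩ := hσ r c b
  exact ⟨⟨Nat.zero_le r, Nat.zero_le c, h3⟩, h1, h2, h4⟩

theorem hasFiniteSupport_matAction (q : ℝ) (u : UGen) {F : PhaseMat} (hF : F.HasFiniteSupport) :
    (matAction q u F).HasFiniteSupport := by
  let P (A : Module.End ℂ PhaseMat) : Prop :=
    ∀ F : PhaseMat, F.HasFiniteSupport → (A F).HasFiniteSupport
  have h (w : ℕ × ℕ × ℤ → ℂ) {σ : ℕ × ℕ × ℤ → ℕ × ℕ × ℤ} (hσ : _) : P (weightedComp w σ) :=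
    fun _ => hasFiniteSupport_weightedComp w (finite_preimage_singleton hσ)
  have hmul {A B : Module.End ℂ PhaseMat} (hA : P A) (hB : P B) : P (A * B) :=
    fun F hF => hA _ (hB F hF)
  have hadd {A B : Module.End ℂ PhaseMat} (a b : ℂ) (hA : P A) (hB : P B) :
      P (a • A + b • B) :=
    fun F hF => .add (.smul_right (fun _ => a) (hA F hF)) (.smul_right (fun _ => b) (hB F hF))
  suffices P (matAction q u) from this F hF
  cases u with
  | H | k | kinv => exact h _ (by intros; dsimp; omega)
  | Xp | Xm =>
    refine hadd _ _ (hmul (h _ ?_) (h _ ?_)) (hmul (h _ ?_) (hmul (h _ ?_) (h _ ?_))) <;>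
      (intros; dsimp; omega)

section FiniteFunctions

variable {q : ℝ} (hq : q ∈ Set.Ioo (0 : ℝ) 1)

theorem distrActionGen_mem_finFun (u : UGen) {f : Distr} (hf : f ∈ FinFun) :
    distrActionGen hq u f ∈ FinFun := by
  rw [mem_finFun_iff hq] at hf ⊢
  rw [matEquiv_distrActionGen]
  exact hasFiniteSupport_matAction q u hf

theorem lift_distrActionGen_mem_finFun (x : FreeAlgebra ℂ UGen) {f : Distr} (hf : f ∈ FinFun) :
    FreeAlgebra.lift ℂ (distrActionGen hq) x f ∈ FinFun := by
  induction x using FreeAlgebra.induction generalizing f with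
  | grade0 c => simpa [Algebra.algebraMap_eq_smul_one] using FinFun.smul_mem c hf
  | grade1 u => rw [FreeAlgebra.lift_ι_apply]; exact distrActionGen_mem_finFun hq u hf
  | mul x y hx hy => rw [map_mul]; exact hx (hy hf)
  | add x y hx hy => rw [map_add]; exact FinFun.add_mem (hx hf) (hy hf)

theorem distrAction_mem_finFun (ξ : Uq q) {f : Distr} (hf : f ∈ FinFun) :
    distrAction hq ξ f ∈ FinFun := by
  obtain ⟨x, rfl⟩ := RingQuot.mkAlgHom_surjective ℂ (URel q) ξ
  rw [distrAction_mk]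
  exact lift_distrActionGen_mem_finFun hq x hf

/-- The representation of `U_q su(1,1)` in the space of finite functions. -/
def finFunAction : Uq q →ₐ[ℂ] Module.End ℂ FinFun :=
  AlgHom.ofLinearMap
    { toFun ξ := (distrAction hq ξ).toLinearMap.restrict fun _ hf => distrAction_mem_finFun hq ξ hf
      map_add' ξ η := by ext1 f; apply Subtype.ext; simp [LinearMap.restrict_apply]
      map_smul' c ξ := by ext1 f; apply Subtype.ext; simp [LinearMap.restrict_apply] }
    (by ext1 f; apply Subtype.ext; simp [LinearMap.restrict_apply])
    (fun ξ η => by ext1 f; apply Subtype.ext; simp [LinearMap.restrict_apply])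

theorem coe_finFunAction (ξ : Uq q) (f : FinFun) :
    (finFunAction hq ξ f : Distr) = distrAction hq ξ f := rfl

end FiniteFunctions

/-! ### The invariant integral -/

theorem tsum_succ_sub {G : ℕ → ℂ} (hG : Summable G) : ∑' m, (G (m + 1) - G m) = -G 0 := by
  rw [((summable_nat_add_iff 1).mpr hG).tsum_sub hG, hG.tsum_eq_zero_add, sub_add_cancel_right]

/-- The functional on matrices that corresponds to `ν / (1 - q²)`: the quantum trace, rescaled as
in `oneMat`. -/
def matTrace (q : ℝ) (F : PhaseMat) : ℂ :=
  ∑' m : ℕ, ((q : ℂ) ^ (2 * m))⁻¹ / shiftFactorial q m * F (m, m, 0)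

theorem matAction_Xp_apply_diag (q : ℝ) (F : PhaseMat) (m : ℕ) :
    matAction q .Xp F (m, m, 0) = kappa q * (qh q ^ 3)⁻¹ * (q : ℂ) ^ m * F (m, m + 1, 1) -
      kappa q * qh q * shiftCoeff q m * (q : ℂ) ^ (m - 1) * F (m - 1, m, 1) := by
  simp only [matAction, scaleMat, rightMulXp, leftMul, leftMulInv12, LinearMap.add_apply,
    LinearMap.smul_apply, Module.End.mul_apply, Pi.add_apply, Pi.smul_apply, smul_eq_mul,
    weightedComp_apply, id_eq, sub_self, zero_add, zpow_zero]
  ring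

theorem matTrace_matAction_Xp {q : ℝ} (hq : q ∈ Set.Ioo (0 : ℝ) 1) {F : PhaseMat}
    (hF : F.HasFiniteSupport) : matTrace q (matAction q .Xp F) = 0 := by
  let G (m : ℕ) : ℂ := kappa q * (qh q)⁻¹ * ((q : ℂ) ^ m)⁻¹ * shiftCoeff q m /
    shiftFactorial q m * F (m - 1, m, 1)
  have hG : Summable G := summable_of_hasFiniteSupport <| .mul_right _ <|
    hF.fun_comp_of_injective fun m n h => congrArg (fun p => p.2.1) h
  have hsub (m : ℕ) : ((q : ℂ) ^ (2 * m))⁻¹ / shiftFactorial q m *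
      matAction q .Xp F (m, m, 0) = G (m + 1) - G m := by
    have h0 := qh_ne_zero hq
    have hw := shiftFactorial_ne_zero hq m
    have ha := shiftCoeff_succ_ne_zero hq m
    dsimp only [G]
    rw [matAction_Xp_apply_diag, Nat.add_sub_cancel, shiftFactorial_succ, qh_mul_self hq]
    rcases m with _ | m
    · simp only [shiftCoeff_zero, mul_zero, zero_mul, zero_div, sub_zero, zero_add]
      field_simp
    · rw [Nat.add_sub_cancel]
      field_simp
      ring
  have hG0 : G 0 = 0 := by simp [G, shiftCoeff_zero]
  rw [matTrace, tsum_congr hsub, tsum_succ_sub hG, hG0, neg_zero]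

theorem matAction_Xm_apply_diag (q : ℝ) (F : PhaseMat) (m : ℕ) :
    matAction q .Xm F (m, m, 0) = kappa q * (qh q ^ 5)⁻¹ * (q : ℂ) ^ (m + 2) * F (m + 1, m, -1) -
      kappa q * (qh q)⁻¹ * (q : ℂ) ^ (m + 1) * shiftCoeff q m * F (m, m - 1, -1) := by
  simp only [matAction, scaleMat, rightMulXm, leftMul, leftMulInv21, LinearMap.add_apply,
    LinearMap.smul_apply, Module.End.mul_apply, Pi.add_apply, Pi.smul_apply, smul_eq_mul,
    weightedComp_apply, id_eq, sub_self, zero_sub, zpow_zero]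
  ring

theorem matTrace_matAction_Xm {q : ℝ} (hq : q ∈ Set.Ioo (0 : ℝ) 1) {F : PhaseMat}
    (hF : F.HasFiniteSupport) : matTrace q (matAction q .Xm F) = 0 := by
  let G (m : ℕ) : ℂ := kappa q * qh q * ((q : ℂ) ^ m)⁻¹ * shiftCoeff q m /
    shiftFactorial q m * F (m, m - 1, -1)
  have hG : Summable G := summable_of_hasFiniteSupport <| .mul_right _ <|
    hF.fun_comp_of_injective fun m n h => congrArg Prod.fst h
  have hsub (m : ℕ) : ((q : ℂ) ^ (2 * m))⁻¹ / shiftFactorial q m *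
      matAction q .Xm F (m, m, 0) = G (m + 1) - G m := by
    have h0 := qh_ne_zero hq
    have hw := shiftFactorial_ne_zero hq m
    have ha := shiftCoeff_succ_ne_zero hq m
    dsimp only [G]
    rw [matAction_Xm_apply_diag, Nat.add_sub_cancel, shiftFactorial_succ, qh_mul_self hq]
    rcases m with _ | m
    · simp only [shiftCoeff_zero, mul_zero, zero_mul, zero_div, sub_zero, zero_add]
      field_simp
    · rw [Nat.add_sub_cancel]
      field_simp
      ring
  have hG0 : G 0 = 0 := by simp [G, shiftCoeff_zero]
  rw [matTrace, tsum_congr hsub, tsum_succ_sub hG, hG0, neg_zero]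

theorem matTrace_matAction {q : ℝ} (hq : q ∈ Set.Ioo (0 : ℝ) 1) (u : UGen) {F : PhaseMat}
    (hF : F.HasFiniteSupport) : matTrace q (matAction q u F) = counitGen u * matTrace q F := by
  cases u with
  | Xp => rw [matTrace_matAction_Xp hq hF, counitGen, zero_mul]
  | Xm => rw [matTrace_matAction_Xm hq hF, counitGen, zero_mul]
  | H | k | kinv => simp [matTrace, matAction, scaleMat, weightedComp_apply, counitGen]

section Integral

variable {q : ℝ} (hq : q ∈ Set.Ioo (0 : ℝ) 1)

theorem nu_eq_matTrace (f : FinFun) :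
    nu q f = (1 - (q : ℂ) ^ 2) * matTrace q (matEquiv hq f) := by
  have h (m : ℕ) : matEquiv hq f (m, m, 0) = shiftFactorial q m * (f : Distr) idx0 m := by
    simpa [entryEquiv_apply, coeffScale, idx0] using matEquiv_apply_entryEquiv hq f idx0 m
  simp only [nu, LinearMap.coe_mk, AddHom.coe_mk, matTrace, h]
  congr! 3 with m
  have hw := shiftFactorial_ne_zero hq m
  field_simp

theorem counit_mk (x : FreeAlgebra ℂ UGen) :
    counit q (RingQuot.mkAlgHom ℂ (URel q) x) = FreeAlgebra.lift ℂ counitGen x := by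
  rw [counit, RingQuot.liftAlgHom_mkAlgHom_apply]

theorem nu_distrActionGen (u : UGen) (f : FinFun) :
    nu q ⟨distrActionGen hq u f, distrActionGen_mem_finFun hq u f.2⟩ = counitGen u * nu q f := by
  rw [nu_eq_matTrace hq, nu_eq_matTrace hq, matEquiv_distrActionGen,
    matTrace_matAction hq u ((mem_finFun_iff hq f).mp f.2), mul_left_comm]

theorem isInvariantIntegral_nu : IsInvariantIntegral (finFunAction hq) (nu q) := by
  intro ξ f
  obtain ⟨x, rfl⟩ := RingQuot.mkAlgHom_surjective ℂ (URel q) ξ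
  induction x using FreeAlgebra.induction generalizing f with
  | grade0 c => simp [Algebra.algebraMap_eq_smul_one]
  | grade1 u =>
    rw [counit_mk, FreeAlgebra.lift_ι_apply, ← nu_distrActionGen hq]
    congr 1
    apply Subtype.ext
    rw [coe_finFunAction, distrAction_mk, FreeAlgebra.lift_ι_apply]
  | mul x y hx hy => simp only [map_mul, Module.End.mul_apply, hx, hy, mul_assoc]
  | add x y hx hy => simp only [map_add, LinearMap.add_apply, hx, hy, add_mul]

end Integral

end QuantumSU11

end

theorem proposition3p2 (q : ℝ) (hq : q ∈ Set.Ioo (0 : ℝ) 1) :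
    ∃ ρ : QuantumSU11.Uq q →ₐ[ℂ] (QuantumSU11.Distr →L[ℂ] QuantumSU11.Distr),
      QuantumSU11.ExtendsPolAction hq ρ ∧
      (∀ ρ' : QuantumSU11.Uq q →ₐ[ℂ] (QuantumSU11.Distr →L[ℂ] QuantumSU11.Distr),
        QuantumSU11.ExtendsPolAction hq ρ' → ρ' = ρ) ∧
      ∃ σ : QuantumSU11.Uq q →ₐ[ℂ] Module.End ℂ QuantumSU11.FinFun,
        (∀ (ξ : QuantumSU11.Uq q) (f : QuantumSU11.FinFun),
          ((σ ξ f : QuantumSU11.FinFun) : QuantumSU11.Distr) = ρ ξ (f : QuantumSU11.Distr)) ∧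
        QuantumSU11.IsInvariantIntegral σ (QuantumSU11.nu q) :=
  ⟨QuantumSU11.distrAction hq, QuantumSU11.extendsPolAction_distrAction hq,
    fun _ h => (QuantumSU11.extendsPolAction_distrAction hq).unique hq h,
    QuantumSU11.finFunAction hq, QuantumSU11.coe_finFunAction hq,
    QuantumSU11.isInvariantIntegral_nu hq⟩
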